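/- Let $q\ge 2$ be an integer, let $\mathfrak X$ be a homogeneous tree of degree $q+1$ (a connected graph without cycles in which every vertex has exactly $q+1$ neighbours), with graph distance $d$, a fixed vertex $o$, and $|x|=d(o,x)$. The Laplacian is $\mathcal Lf(x)=f(x)-\frac1{q+1}\sum_{y:\,d(x,y)=1}f(y)$. For $1<p<2$ let $\mathcal S_p(\mathfrak X)$ be the space of all $f:\mathfrak X\to\mathbb C$ with $$\nu_m(f)=\sup_{x\in\mathfrak X}(1+|x|)^m q^{|x|/p}|f(x)|<\infty\quad\text{for all } m\in\mathbb Z_{\ge 0},$$ topologized by the seminorms $\nu_m$. An $L^p$-tempered distribution is a linear functional $T:\mathcal S_p(\mathfrak X)\to\mathbb C$ such that $\langle T,f_n\rangle\to0$ whenever $\nu_m(f_n)\to0$ for all $m$; its Laplacian is defined by $\langle\mathcal LT,\phi\rangle=\langle T,\mathcal L\phi\rangle$. Put $$\gamma(z)=1-\frac{q^{1/2+iz}+q^{1/2-iz}}{q+1},\qquad \tau=\frac{2\pi}{\log q},\qquad p'=\frac p{p-1},\qquad \delta_{p'}=\frac1{p'}-\frac12 .$$ The numbers $\gamma(i\delta_{p'})$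 and $\gamma(\tau/2+i\delta_{p'})$ are real. Let $1<p<2$ and $0\ne\lambda\in\mathbb C$. Consider sequences $\{T_{-k}\}_{k\ge0}$ of $L^p$-tempered distributions on $\mathfrak X$ satisfying 1. $\mathcal L T_{-k}=\lambda T_{-k+1}$ for all $k\ge1$, and 2. there are $M>0$ and a continuous seminorm $\nu$ on $\mathcal S_p(\mathfrak X)$ such that $|\langle T_{-k},\phi\rangle|\le M\nu(\phi)$ for all $k\ge0$ and all $\phi\in\mathcal S_p(\mathfrak X)$. Then the following hold. (a) If $|\lambda|=\gamma(\tau/2+i\delta_{p'})$, then every such sequence satisfies $\mathcal LT_0=|\lambda|\,T_0$. (b) If $|\lambda|>\gamma(\tau/2+i\delta_{p'})$, then every such sequence satisfies $T_{-k}=0$ for all $k\ge0$. (c) If $\gamma(i\delta_{p'})<|\lambda|<\gamma(\tau/2+i\delta_{p'})$, then there is such a sequence for which $T_0$ is not an eigendistribution of $\mathcal L$, i.e. there is no $\mu\in\mathbb C$ with $\mathcal LT_0=\mu T_0$. -/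

import Mathlib

open scoped Topology

noncomputable section

namespace HomTree

/-- `G` is a homogeneous tree of degree `q + 1`. -/
structure IsHomogeneousTree {V : Type*} (G : SimpleGraph V) [G.LocallyFinite] (q : ℕ) : Prop where
  tree : G.IsTree
  regular : G.IsRegularOfDegree (q + 1)

/-- `𝓛 f (x) = f(x) - (q + 1)⁻¹ ∑_{d(x,y) = 1} f(y)`. -/
def laplacian {V : Type*} (G : SimpleGraph V) [G.LocallyFinite] (q : ℕ) :
    (V → ℂ) →ₗ[ℂ] (V → ℂ) where
  toFun f := fun x => f x - (1 / ((q : ℂ) + 1)) * ∑ y ∈ G.neighborFinset x, f y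
  map_add' f g := by
    funext x
    simp only [Pi.add_apply, Finset.sum_add_distrib]
    ring
  map_smul' c f := by
    funext x
    simp only [Pi.smul_apply, smul_eq_mul, ← Finset.mul_sum, RingHom.id_apply]
    ring

/-- The weight `(1 + |x|)^m q^{|x|/p}`, where `|x| = d(o, x)`. -/
def weight {V : Type*} (G : SimpleGraph V) (q : ℕ) (o : V) (p : ℝ) (m : ℕ) (x : V) : ℝ :=
  (1 + (G.dist o x : ℝ)) ^ m * (q : ℝ) ^ ((G.dist o x : ℝ) / p)

theorem weight_nonneg {V : Type*} (G : SimpleGraph V) (q : ℕ) (o : V) (p : ℝ) (m : ℕ) (x : V) :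
    0 ≤ weight G q o p m x := by
  unfold weight
  positivity

/-- The `p`-Schwartz space `𝓢_p` of the tree (with base point `o`): the functions `f` with
`sup_x (1 + |x|)^m q^{|x|/p} |f(x)| < ∞` for every `m`. -/
def schwartz {V : Type*} (G : SimpleGraph V) (q : ℕ) (o : V) (p : ℝ) : Submodule ℂ (V → ℂ) where
  carrier := {f | ∀ m : ℕ, BddAbove (Set.range fun x => weight G q o p m x * ‖f x‖)}
  zero_mem' := by
    intro m
    refine ⟨0, ?_⟩
    rintro _ ⟨x, rfl⟩
    simp
  add_mem' := by
    intro f g hf hg m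
    obtain ⟨a, ha⟩ := hf m
    obtain ⟨b, hb⟩ := hg m
    refine ⟨a + b, ?_⟩
    rintro _ ⟨x, rfl⟩
    have h1 := ha ⟨x, rfl⟩
    have h2 := hb ⟨x, rfl⟩
    have h3 := mul_le_mul_of_nonneg_left (norm_add_le (f x) (g x)) (weight_nonneg G q o p m x)
    simp only [Pi.add_apply] at *
    linarith
  smul_mem' := by
    intro c f hf m
    obtain ⟨a, ha⟩ := hf m
    refine ⟨‖c‖ * a, ?_⟩
    rintro _ ⟨x, rfl⟩
    have h1 := mul_le_mul_of_nonneg_left (ha ⟨x, rfl⟩) (norm_nonneg c)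
    simp only [Pi.smul_apply, smul_eq_mul, norm_mul] at *
    linarith

/-- The seminorm `ν_m(f) = sup_x (1 + |x|)^m q^{|x|/p} |f(x)|` on `𝓢_p`. -/
def nu {V : Type*} (G : SimpleGraph V) (q : ℕ) (o : V) (p : ℝ) (m : ℕ) :
    Seminorm ℂ (schwartz G q o p) :=
  Seminorm.of (fun f => ⨆ x, weight G q o p m x * ‖(f : V → ℂ) x‖)
    (by
      intro f g
      have : Nonempty V := ⟨o⟩
      refine ciSup_le fun x => ?_
      have h1 := le_ciSup (f.2 m) x
      have h2 := le_ciSup (g.2 m) x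
      have h3 := mul_le_mul_of_nonneg_left (norm_add_le ((f : V → ℂ) x) ((g : V → ℂ) x))
        (weight_nonneg G q o p m x)
      simp only [Submodule.coe_add, Pi.add_apply] at *
      linarith)
    (by
      intro c f
      rw [Real.mul_iSup_of_nonneg (norm_nonneg c)]
      congr 1
      funext x
      simp only [Submodule.coe_smul, Pi.smul_apply, smul_eq_mul, norm_mul]
      ring)

theorem weight_le_of_adj {V : Type*} {G : SimpleGraph V} {q : ℕ}
    (hq : 2 ≤ q) (o : V) (p : ℝ) (m : ℕ) {x y : V} (h : G.Adj x y) :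
    weight G q o p m x ≤ 2 ^ m * (q : ℝ) ^ |1 / p| * weight G q o p m y := by
  have hd : |(G.dist o x : ℝ) - G.dist o y| ≤ 1 := by
    have h1 : G.dist o x ≤ G.dist o y + 1 := by
      rcases h.symm.diff_dist_adj (u := o) with h | h | h <;> omega
    have h2 : G.dist o y ≤ G.dist o x + 1 := by
      rcases h.diff_dist_adj (u := o) with h | h | h <;> omega
    have h1' : (G.dist o x : ℝ) ≤ G.dist o y + 1 := by exact_mod_cast h1
    have h2' : (G.dist o y : ℝ) ≤ G.dist o x + 1 := by exact_mod_cast h2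
    rw [abs_le]
    constructor <;> linarith
  have hd' := abs_le.1 hd
  have hq1 : (1 : ℝ) ≤ q := by exact_mod_cast (by omega : 1 ≤ q)
  have hq0 : (0 : ℝ) < q := by linarith
  have hy : (0 : ℝ) ≤ G.dist o y := by positivity
  have e1 : (1 + (G.dist o x : ℝ)) ^ m ≤ 2 ^ m * (1 + (G.dist o y : ℝ)) ^ m := by
    rw [← mul_pow]
    exact pow_le_pow_left₀ (by positivity) (by linarith) m
  have e2 : (q : ℝ) ^ ((G.dist o x : ℝ) / p)
      ≤ (q : ℝ) ^ |1 / p| * (q : ℝ) ^ ((G.dist o y : ℝ) / p) := by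
    rw [← Real.rpow_add hq0]
    refine Real.rpow_le_rpow_of_exponent_le hq1 ?_
    have : ((G.dist o x : ℝ) - G.dist o y) * (1 / p) ≤ 1 * |1 / p| :=
      (le_abs_self _).trans (by
        rw [abs_mul]
        exact mul_le_mul_of_nonneg_right hd (abs_nonneg _))
    have e : ((G.dist o x : ℝ) - G.dist o y) * (1 / p)
        = (G.dist o x : ℝ) / p - (G.dist o y : ℝ) / p := by ring
    linarith
  unfold weight
  calc _ ≤ (2 ^ m * (1 + (G.dist o y : ℝ)) ^ m) *
        ((q : ℝ) ^ |1 / p| * (q : ℝ) ^ ((G.dist o y : ℝ) / p)) :=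
        mul_le_mul e1 e2 (by positivity) (by positivity)
    _ = _ := by ring

/-- `𝓛` maps `𝓢_p` to itself. -/
theorem laplacian_mem_schwartz {V : Type*} {G : SimpleGraph V} [G.LocallyFinite] {q : ℕ}
    (hG : IsHomogeneousTree G q) (hq : 2 ≤ q) (o : V) (p : ℝ) (f : V → ℂ)
    (hf : f ∈ schwartz G q o p) : laplacian G q f ∈ schwartz G q o p := by
  intro m
  obtain ⟨a, ha⟩ := hf m
  set C : ℝ := 2 ^ m * (q : ℝ) ^ |1 / p| with hC
  have hC0 : 0 ≤ C := by positivity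
  have hn : ‖1 / ((q : ℂ) + 1)‖ = 1 / ((q : ℝ) + 1) := by
    rw [norm_div, norm_one]
    congr 1
    exact_mod_cast Complex.norm_natCast (q + 1)
  refine ⟨a + C * a, ?_⟩
  rintro _ ⟨x, rfl⟩
  have hw := weight_nonneg G q o p m x
  have h1 : weight G q o p m x * ‖f x‖ ≤ a := ha ⟨x, rfl⟩
  have h2 : ∑ y ∈ G.neighborFinset x, weight G q o p m x * ‖f y‖ ≤ ((q : ℝ) + 1) * (C * a) := by
    have : ∑ y ∈ G.neighborFinset x, weight G q o p m x * ‖f y‖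
        ≤ ∑ y ∈ G.neighborFinset x, C * a := by
      refine Finset.sum_le_sum fun y hy => ?_
      have hadj : G.Adj x y := by simpa using hy
      have hb : weight G q o p m y * ‖f y‖ ≤ a := ha ⟨y, rfl⟩
      calc _ ≤ (C * weight G q o p m y) * ‖f y‖ :=
            mul_le_mul_of_nonneg_right (weight_le_of_adj hq o p m hadj) (norm_nonneg _)
        _ = C * (weight G q o p m y * ‖f y‖) := by ring
        _ ≤ C * a := mul_le_mul_of_nonneg_left hb hC0
    refine this.trans (le_of_eq ?_)
    rw [Finset.sum_const, G.card_neighborFinset_eq_degree, hG.regular x, nsmul_eq_mul]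
    push_cast
    ring
  have h3 : ‖laplacian G q f x‖
      ≤ ‖f x‖ + 1 / ((q : ℝ) + 1) * ∑ y ∈ G.neighborFinset x, ‖f y‖ := by
    refine (norm_sub_le _ _).trans ?_
    rw [norm_mul, hn]
    gcongr
    exact norm_sum_le _ _
  have hq1 : (0 : ℝ) < (q : ℝ) + 1 := by positivity
  calc weight G q o p m x * ‖laplacian G q f x‖
      ≤ weight G q o p m x * (‖f x‖ + 1 / ((q : ℝ) + 1) * ∑ y ∈ G.neighborFinset x, ‖f y‖) :=
        mul_le_mul_of_nonneg_left h3 hw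
    _ = weight G q o p m x * ‖f x‖
        + 1 / ((q : ℝ) + 1) * ∑ y ∈ G.neighborFinset x, weight G q o p m x * ‖f y‖ := by
        rw [← Finset.mul_sum]
        ring
    _ ≤ a + 1 / ((q : ℝ) + 1) * (((q : ℝ) + 1) * (C * a)) := by gcongr
    _ = a + C * a := by field_simp

/-- `T` is an `L^p`-tempered distribution: a linear functional on `𝓢_p` such that
`⟨T, f_n⟩ → 0` whenever `ν_m(f_n) → 0` for all `m`. -/
def IsTempered {V : Type*} {G : SimpleGraph V} {q : ℕ} {o : V} {p : ℝ}
    (T : schwartz G q o p →ₗ[ℂ] ℂ) : Prop :=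
  ∀ f : ℕ → schwartz G q o p,
    (∀ m : ℕ, Filter.Tendsto (fun n => nu G q o p m (f n)) Filter.atTop (𝓝 0)) →
      Filter.Tendsto (fun n => T (f n)) Filter.atTop (𝓝 0)

/-- The Laplacian of a distribution, `⟨𝓛T, φ⟩ = ⟨T, 𝓛φ⟩`. -/
def distLaplacian {V : Type*} {G : SimpleGraph V} [G.LocallyFinite] {q : ℕ}
    (hG : IsHomogeneousTree G q) (hq : 2 ≤ q) {o : V} {p : ℝ}
    (T : schwartz G q o p →ₗ[ℂ] ℂ) : schwartz G q o p →ₗ[ℂ] ℂ :=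
  T ∘ₗ (laplacian G q).restrict (laplacian_mem_schwartz hG hq o p)

/-- `ν` is continuous for the topology defined by the (increasing) family of seminorms `ν_m`. -/
def IsContinuousSeminorm {V : Type*} {G : SimpleGraph V} {q : ℕ} {o : V} {p : ℝ}
    (ν : Seminorm ℂ (schwartz G q o p)) : Prop :=
  ∃ (m : ℕ) (C : ℝ), ∀ φ, ν φ ≤ C * nu G q o p m φ

/-- The standing hypotheses on a backward sequence; `T k` stands for `T_{-k}`. -/
structure IsBackwardSolution {V : Type*} {G : SimpleGraph V} [G.LocallyFinite] {q : ℕ}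
    (hG : IsHomogeneousTree G q) (hq : 2 ≤ q) {o : V} {p : ℝ} (lam : ℂ)
    (T : ℕ → (schwartz G q o p →ₗ[ℂ] ℂ)) : Prop where
  tempered : ∀ k, IsTempered (T k)
  laplacian_eq : ∀ k, distLaplacian hG hq (T (k + 1)) = lam • T k
  bounded : ∃ ν : Seminorm ℂ (schwartz G q o p), IsContinuousSeminorm ν ∧
    ∃ M : ℝ, 0 < M ∧ ∀ k φ, ‖T k φ‖ ≤ M * ν φ

/-- `γ(z) = 1 - (q^{1/2+iz} + q^{1/2-iz}) / (q + 1)`. -/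
def gam (q : ℕ) (z : ℂ) : ℂ :=
  1 - ((q : ℂ) ^ (1 / 2 + Complex.I * z) + (q : ℂ) ^ (1 / 2 - Complex.I * z)) / ((q : ℂ) + 1)

/-- `τ = 2π / log q`. -/
def tau (q : ℕ) : ℝ := 2 * Real.pi / Real.log q

/-- `δ_p = 1/p - 1/2`. -/
def delta (p : ℝ) : ℝ := 1 / p - 1 / 2

/-- `γ(iδ_{p'})`, with `p'` the conjugate exponent (a real number). -/
def gamLow (q : ℕ) (p : ℝ) : ℝ :=
  (gam q (Complex.I * (delta p.conjExponent : ℂ))).re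

/-- `γ(τ/2 + iδ_{p'})`, with `p'` the conjugate exponent (a real number). -/
def gamHigh (q : ℕ) (p : ℝ) : ℝ :=
  (gam q ((tau q : ℂ) / 2 + Complex.I * (delta p.conjExponent : ℂ))).re

/-- The value `γ(iδ_{p'})` is real. -/
theorem gam_eq_gamLow (q : ℕ) (p : ℝ) :
    gam q (Complex.I * (delta p.conjExponent : ℂ)) = (gamLow q p : ℂ) := by
  set d : ℝ := delta p.conjExponent with hd
  have h : gam q (Complex.I * (d : ℂ)) =
      ((1 - ((q : ℝ) ^ (1 / 2 - d) + (q : ℝ) ^ (1 / 2 + d)) / ((q : ℝ) + 1) : ℝ) : ℂ) := by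
    have e1 : 1 / 2 + Complex.I * (Complex.I * (d : ℂ)) = ((1 / 2 - d : ℝ) : ℂ) := by
      push_cast
      linear_combination (d : ℂ) * Complex.I_mul_I
    have e2 : 1 / 2 - Complex.I * (Complex.I * (d : ℂ)) = ((1 / 2 + d : ℝ) : ℂ) := by
      push_cast
      linear_combination -(d : ℂ) * Complex.I_mul_I
    rw [gam, e1, e2]
    push_cast [Complex.ofReal_cpow (Nat.cast_nonneg q)]
    rfl
  rw [gamLow, ← hd, h, Complex.ofReal_re]

/-- The value `γ(τ/2 + iδ_{p'})` is real. -/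
theorem gam_eq_gamHigh (q : ℕ) (hq : 2 ≤ q) (p : ℝ) :
    gam q ((tau q : ℂ) / 2 + Complex.I * (delta p.conjExponent : ℂ)) = (gamHigh q p : ℂ) := by
  set d : ℝ := delta p.conjExponent with hd
  have hq0 : (q : ℂ) ≠ 0 := by exact_mod_cast (by omega : q ≠ 0)
  have hl : Complex.log (q : ℂ) = ((Real.log q : ℝ) : ℂ) := by
    rw [Complex.ofReal_log (Nat.cast_nonneg q), Complex.ofReal_natCast]
  have hl0 : ((Real.log q : ℝ) : ℂ) ≠ 0 := by
    exact_mod_cast (Real.log_pos (by exact_mod_cast (by omega : 1 < q))).ne'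
  have hpi : (q : ℂ) ^ (Complex.I * ((tau q : ℂ) / 2)) = -1 := by
    rw [Complex.cpow_def_of_ne_zero hq0, hl, ← Complex.exp_pi_mul_I, tau]
    congr 1
    push_cast
    push_cast at hl0
    field_simp
  have h : gam q ((tau q : ℂ) / 2 + Complex.I * (d : ℂ)) =
      ((1 + ((q : ℝ) ^ (1 / 2 - d) + (q : ℝ) ^ (1 / 2 + d)) / ((q : ℝ) + 1) : ℝ) : ℂ) := by
    have e1 : 1 / 2 + Complex.I * ((tau q : ℂ) / 2 + Complex.I * (d : ℂ))
        = ((1 / 2 - d : ℝ) : ℂ) + Complex.I * ((tau q : ℂ) / 2) := by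
      push_cast
      linear_combination (d : ℂ) * Complex.I_mul_I
    have e2 : 1 / 2 - Complex.I * ((tau q : ℂ) / 2 + Complex.I * (d : ℂ))
        = ((1 / 2 + d : ℝ) : ℂ) - Complex.I * ((tau q : ℂ) / 2) := by
      push_cast
      linear_combination -(d : ℂ) * Complex.I_mul_I
    rw [gam, e1, e2, Complex.cpow_add _ _ hq0, Complex.cpow_sub _ _ hq0, hpi]
    push_cast [Complex.ofReal_cpow (Nat.cast_nonneg q)]
    ring
  rw [gamHigh, ← hd, h, Complex.ofReal_re]

end HomTree

end

/-! Let `A = 1 - 𝓛` be the averaging operator and `s = rad q p`; the two thresholds are `1 - s` and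
`1 + s`. The function `q^{-|x|/p}` satisfies `A w ≤ s w`, and `k` averagings see only distance `k`,
so `ν_m(A^k φ) ≤ (1 + k)^m s^k ν_m(φ)` (`nu_avg_pow_le`). Hence `B = -A/s` has polynomially bounded
powers, and `𝓛 = (1 + s)((1 - t) + tB)` with `t = s/(1 + s)` is, up to scale, a convex combination
of `1` and `B`.

The backward relation gives `λ^k T_{-j}(φ) = T_{-j-k}(𝓛^k φ)`, whose right side is `O((1 + s)^k (1 +
k)^m)`. If `|λ| > 1 + s`, this forces `T_{-j} = 0`.

If `|λ| = 1 + s`, write `c = 1 + s`, so `𝓛 - c = s(B - 1)`. The polynomial `(1 - t + tX)^n (X - 1)`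
has coefficient `ℓ¹` norm `O(n^{-1/2})`, by the binomial variance
(`coeffNorm_linear_pow_mul_sq_le`). A sufficiently high power of it beats the growth `n^m`, so some
power of `𝓛 - c` kills every `T_{-k}`. A nontrivial Jordan block would make the sequence grow
linearly, against boundedness, so the first power already does (`backward_apply_eq_zero_of_pow`).

If `1 - s < |λ| < 1 + s`, bounded eigendistributions come from radial eigenfunctions whose
eigenvalues fill an ellipse about `1`. It contains a non-real `α` with `|α| = |λ|`, and also its
conjugate; superposing the two gives a bounded sequence whose `T_0` is not an eigendistribution. -/

open scoped Topology

noncomputable section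

namespace HomTree

/-! ### Neighbours and spheres in a homogeneous tree. -/

section Tree

variable {V : Type*} {G : SimpleGraph V}

/-- In a tree every vertex other than the root has exactly one neighbour closer to the root. -/
theorem existsUnique_adj_dist (hG : G.IsTree) {o x : V} (hx : x ≠ o) :
    ∃! y, G.Adj x y ∧ G.dist o y + 1 = G.dist o x := by
  classical
  obtain ⟨w, hw⟩ := hG.connected.exists_walk_length_eq_dist x o
  have hpath : ∀ y, ∀ h : G.Adj x y, G.dist o y + 1 = G.dist o x →
      ∃ w' : G.Walk y o, (SimpleGraph.Walk.cons h w').IsPath := by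
    intro y h hy
    obtain ⟨w', hw'⟩ := hG.connected.exists_walk_length_eq_dist y o
    refine ⟨w', SimpleGraph.Walk.isPath_of_length_eq_dist _ ?_⟩
    rw [SimpleGraph.Walk.length_cons, hw', G.dist_comm (u := y), G.dist_comm (u := x), hy]
  cases w with
  | nil => exact absurd rfl hx
  | @cons _ y _ h w =>
    have hy : G.dist o y + 1 = G.dist o x := by
      have h1 := G.dist_le w
      rw [SimpleGraph.Walk.length_cons] at hw
      rw [G.dist_comm (u := y)] at h1
      rw [G.dist_comm (u := x)] at hw
      rcases hG.dist_eq_dist_add_one_of_adj o h with h2 | h2 <;> omega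
    refine ⟨y, ⟨h, hy⟩, ?_⟩
    rintro z ⟨hz, hz'⟩
    obtain ⟨w1, h1⟩ := hpath y h hy
    obtain ⟨w2, h2⟩ := hpath z hz hz'
    have := (hG.existsUnique_path x o).unique h1 h2
    simpa using (congrArg SimpleGraph.Walk.snd this).symm

variable [G.LocallyFinite] {q : ℕ}

/-- Away from the root a vertex has one parent, and adjacent vertices of a tree never lie at equal
distance from the root, so the other `q` neighbours are children. -/
theorem sum_neighborFinset_radial (hG : IsHomogeneousTree G q) {M : Type*} [AddCommMonoid M]
    (F : ℕ → M) {o x : V} (hx : x ≠ o) :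
    ∑ y ∈ G.neighborFinset x, F (G.dist o y)
      = F (G.dist o x - 1) + q • F (G.dist o x + 1) := by
  classical
  obtain ⟨y, ⟨hy, hyd⟩, huniq⟩ := existsUnique_adj_dist hG.tree hx
  have hmem : y ∈ G.neighborFinset x := by simpa using hy
  rw [← Finset.add_sum_erase _ _ hmem]
  have hcard : ((G.neighborFinset x).erase y).card = q := by
    rw [Finset.card_erase_of_mem hmem, G.card_neighborFinset_eq_degree, hG.regular x]
    rfl
  rw [← hcard, ← Finset.sum_const]
  congr 1
  · congr 1; omega
  · refine Finset.sum_congr rfl fun z hz => ?_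
    obtain ⟨hzy, hz⟩ := Finset.mem_erase.1 hz
    have hz : G.Adj x z := by simpa using hz
    rcases hG.tree.dist_eq_dist_add_one_of_adj o hz with h | h
    · exact absurd (huniq z ⟨hz, h.symm⟩) hzy
    · rw [h]

theorem sum_neighborFinset_radial_root (hG : IsHomogeneousTree G q) {M : Type*}
    [AddCommMonoid M] (F : ℕ → M) (o : V) :
    ∑ y ∈ G.neighborFinset o, F (G.dist o y) = (q + 1) • F 1 := by
  rw [← hG.regular o, ← G.card_neighborFinset_eq_degree, ← Finset.sum_const]
  refine Finset.sum_congr rfl fun z hz => ?_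
  rw [SimpleGraph.dist_eq_one_iff_adj.2 (by simpa using hz)]

/-- Each sphere consists of the children of the previous one. At `n = 0` the truncated exponent
gives the crude bound `q + 1`. -/
theorem exists_finset_sphere (hG : IsHomogeneousTree G q) (o : V) (n : ℕ) :
    ∃ S : Finset V, (∀ x, x ∈ S ↔ G.dist o x = n) ∧ S.card ≤ (q + 1) * q ^ (n - 1) := by
  classical
  rcases n with _ | n
  · refine ⟨{o}, fun x => ?_, by simp⟩
    rw [Finset.mem_singleton, hG.tree.connected.dist_eq_zero_iff]
    exact eq_comm
  induction n with
  | zero =>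
    refine ⟨G.neighborFinset o, fun x => ?_, ?_⟩
    · rw [zero_add, SimpleGraph.dist_eq_one_iff_adj, SimpleGraph.mem_neighborFinset]
    · rw [G.card_neighborFinset_eq_degree, hG.regular o]
      simp
  | succ n ih =>
    obtain ⟨S, hS, hc⟩ := ih
    refine ⟨S.biUnion fun x => (G.neighborFinset x).filter fun y => G.dist o y = n + 2,
      fun y => ?_, ?_⟩
    · simp only [Finset.mem_biUnion, Finset.mem_filter, SimpleGraph.mem_neighborFinset]
      constructor
      · rintro ⟨x, -, -, h⟩
        exact h
      · intro h
        have hy : y ≠ o := by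
          rintro rfl
          simp at h
        obtain ⟨x, ⟨hx, hxd⟩, -⟩ := existsUnique_adj_dist hG.tree hy
        exact ⟨x, (hS x).2 (by omega), hx.symm, h⟩
    · refine Finset.card_biUnion_le.trans ?_
      have : ∀ x ∈ S, ((G.neighborFinset x).filter fun y => G.dist o y = n + 2).card = q := by
        intro x hx
        have hxn := (hS x).1 hx
        have hxo : x ≠ o := by
          rintro rfl
          simp at hxn
        rw [Finset.card_filter,
          sum_neighborFinset_radial hG (fun k => if k = n + 2 then 1 else 0) hxo, hxn]
        simp
      rw [Finset.sum_congr rfl this, Finset.sum_const, smul_eq_mul]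
      calc S.card * q ≤ (q + 1) * q ^ (n + 1 - 1) * q := Nat.mul_le_mul_right _ hc
        _ = (q + 1) * q ^ (n + 1 + 1 - 1) := by simp [pow_succ]; ring

end Tree

/-! ### The thresholds as `1 ± rad q p`. -/

/-- The spectral radius `(q^{1/p} + q^{1-1/p}) / (q + 1)` of the averaging operator on `𝓢_p`. -/
def rad (q : ℕ) (p : ℝ) : ℝ := ((q : ℝ) ^ (1 / p) + (q : ℝ) ^ (1 - 1 / p)) / ((q : ℝ) + 1)

theorem rad_pos {q : ℕ} (hq : 2 ≤ q) (p : ℝ) : 0 < rad q p := by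
  have : (0 : ℝ) < q := by positivity
  unfold rad
  positivity

theorem delta_conjExponent {p : ℝ} (hp1 : 1 < p) : delta p.conjExponent = 1 / 2 - 1 / p := by
  have h1 : p ≠ 0 := by positivity
  have h2 : p - 1 ≠ 0 := by linarith
  rw [delta, Real.conjExponent]
  field_simp
  ring

theorem gamLow_eq (q : ℕ) {p : ℝ} (hp1 : 1 < p) : gamLow q p = 1 - rad q p := by
  have h := gam_eq_gamLow q p
  rw [delta_conjExponent hp1] at h
  have e1 : 1 / 2 + Complex.I * (Complex.I * ((1 / 2 - 1 / p : ℝ) : ℂ)) = ((1 / p : ℝ) : ℂ) := by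
    push_cast
    linear_combination (1 / 2 - 1 / p : ℂ) * Complex.I_mul_I
  have e2 : 1 / 2 - Complex.I * (Complex.I * ((1 / 2 - 1 / p : ℝ) : ℂ))
      = ((1 - 1 / p : ℝ) : ℂ) := by
    push_cast
    linear_combination -(1 / 2 - 1 / p : ℂ) * Complex.I_mul_I
  rw [gam, e1, e2, ← Complex.ofReal_natCast, ← Complex.ofReal_cpow (Nat.cast_nonneg q),
    ← Complex.ofReal_cpow (Nat.cast_nonneg q)] at h
  rw [rad]
  exact_mod_cast h.symm

/-- The shift by `τ/2` multiplies both powers of `q` by `q^{±iτ/2} = -1`, which flips the sign in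
front of `rad q p`. -/
theorem gamHigh_eq {q : ℕ} (hq : 2 ≤ q) {p : ℝ} (hp1 : 1 < p) : gamHigh q p = 1 + rad q p := by
  have hq0 : (q : ℂ) ≠ 0 := by exact_mod_cast (by omega : q ≠ 0)
  have hl : Complex.log (q : ℂ) = ((Real.log q : ℝ) : ℂ) := by
    rw [Complex.ofReal_log (Nat.cast_nonneg q), Complex.ofReal_natCast]
  have hl0 : ((Real.log q : ℝ) : ℂ) ≠ 0 := by
    exact_mod_cast (Real.log_pos (by exact_mod_cast (by omega : 1 < q))).ne'
  have hpi : (q : ℂ) ^ (Complex.I * ((tau q : ℂ) / 2)) = -1 := by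
    rw [Complex.cpow_def_of_ne_zero hq0, hl, ← Complex.exp_pi_mul_I, tau]
    congr 1
    push_cast
    push_cast at hl0
    field_simp
  have h := gam_eq_gamHigh q hq p
  rw [delta_conjExponent hp1] at h
  have e1 : 1 / 2 + Complex.I * ((tau q : ℂ) / 2 + Complex.I * ((1 / 2 - 1 / p : ℝ) : ℂ))
      = ((1 / p : ℝ) : ℂ) + Complex.I * ((tau q : ℂ) / 2) := by
    push_cast
    linear_combination (1 / 2 - 1 / p : ℂ) * Complex.I_mul_I
  have e2 : 1 / 2 - Complex.I * ((tau q : ℂ) / 2 + Complex.I * ((1 / 2 - 1 / p : ℝ) : ℂ))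
      = ((1 - 1 / p : ℝ) : ℂ) - Complex.I * ((tau q : ℂ) / 2) := by
    push_cast
    linear_combination -(1 / 2 - 1 / p : ℂ) * Complex.I_mul_I
  rw [gam, e1, e2, Complex.cpow_add _ _ hq0, Complex.cpow_sub _ _ hq0, hpi,
    ← Complex.ofReal_natCast, ← Complex.ofReal_cpow (Nat.cast_nonneg q),
    ← Complex.ofReal_cpow (Nat.cast_nonneg q)] at h
  have h' : gamHigh q p = 1 - ((q : ℝ) ^ (1 / p) * (-1) + (q : ℝ) ^ (1 - 1 / p) / (-1))
      / ((q : ℝ) + 1) := by exact_mod_cast h.symm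
  rw [h', rad]
  ring

theorem weight_mul_le_nu {V : Type*} {G : SimpleGraph V} {q : ℕ} {o : V} {p : ℝ}
    (m : ℕ) (φ : schwartz G q o p) (x : V) :
    weight G q o p m x * ‖(φ : V → ℂ) x‖ ≤ nu G q o p m φ :=
  le_ciSup (φ.2 m) x

theorem norm_apply_le_nu {V : Type*} {G : SimpleGraph V} {q : ℕ} (hq : 2 ≤ q) {o : V} {p : ℝ}
    (m : ℕ) (φ : schwartz G q o p) (x : V) :
    ‖(φ : V → ℂ) x‖ ≤ nu G q o p m φ / (1 + (G.dist o x : ℝ)) ^ m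
      * (q : ℝ) ^ (-((G.dist o x : ℝ) / p)) := by
  have hq0 : (0 : ℝ) < q := by positivity
  have h := weight_mul_le_nu m φ x
  have hw : 0 < weight G q o p m x := by
    unfold weight
    positivity
  rw [Real.rpow_neg hq0.le, ← div_eq_mul_inv, div_div, le_div_iff₀' (by positivity)]
  exact h

/-! ### Growth of the powers of the averaging operator. -/

section Averaging

variable {V : Type*} {G : SimpleGraph V} [G.LocallyFinite] {q : ℕ}

/-- The Laplacian as an endomorphism of the Schwartz space. -/
abbrev lap (hG : IsHomogeneousTree G q) (hq : 2 ≤ q) (o : V) (p : ℝ) :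
    Module.End ℂ (schwartz G q o p) :=
  (laplacian G q).restrict (laplacian_mem_schwartz hG hq o p)

/-- The averaging operator `1 - 𝓛` on the Schwartz space. -/
def avg (hG : IsHomogeneousTree G q) (hq : 2 ≤ q) (o : V) (p : ℝ) :
    Module.End ℂ (schwartz G q o p) := 1 - lap hG hq o p

theorem avg_apply (hG : IsHomogeneousTree G q) (hq : 2 ≤ q) (o : V) (p : ℝ)
    (φ : schwartz G q o p) (x : V) :
    (avg hG hq o p φ : V → ℂ) x
      = (1 / ((q : ℂ) + 1)) * ∑ y ∈ G.neighborFinset x, (φ : V → ℂ) y := by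
  simp [avg, laplacian]

/-- The function `q^{-|x|/p}` is superharmonic up to the factor `rad q p`. -/
theorem sum_rpow_neg_dist_le (hG : IsHomogeneousTree G q) (hq : 2 ≤ q) (o : V) {p : ℝ}
    (hp1 : 1 < p) (x : V) :
    ∑ y ∈ G.neighborFinset x, (q : ℝ) ^ (-((G.dist o y : ℝ) / p))
      ≤ ((q : ℝ) + 1) * (rad q p * (q : ℝ) ^ (-((G.dist o x : ℝ) / p))) := by
  have hq1 : (1 : ℝ) ≤ q := by exact_mod_cast (by omega : 1 ≤ q)
  have hq0 : (0 : ℝ) < q := by linarith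
  have hrad : ((q : ℝ) + 1) * rad q p = (q : ℝ) ^ (1 / p) + (q : ℝ) ^ (1 - 1 / p) := by
    rw [rad]
    field_simp
  rw [← mul_assoc, hrad]
  by_cases hx : x = o
  · subst hx
    rw [sum_neighborFinset_radial_root hG (fun n : ℕ => (q : ℝ) ^ (-((n : ℝ) / p)))]
    simp only [nsmul_eq_mul, SimpleGraph.dist_self, Nat.cast_zero, zero_div, neg_zero,
      Real.rpow_zero, mul_one, Nat.cast_one]
    push_cast
    have h1 : (q : ℝ) ^ (1 - 1 / p) = q * (q : ℝ) ^ (-(1 / p)) := by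
      rw [sub_eq_add_neg, Real.rpow_add hq0, Real.rpow_one]
    have h2 : (q : ℝ) ^ (-(1 / p)) ≤ (q : ℝ) ^ (1 / p) :=
      Real.rpow_le_rpow_of_exponent_le hq1 (by
        have : 0 < 1 / p := by positivity
        linarith)
    rw [h1]
    linarith
  · rw [sum_neighborFinset_radial hG (fun n : ℕ => (q : ℝ) ^ (-((n : ℝ) / p))) hx]
    have hpos : 0 < G.dist o x := hG.tree.connected.pos_dist_of_ne (Ne.symm hx)
    rw [nsmul_eq_mul, Nat.cast_sub hpos, add_mul, ← Real.rpow_add hq0, ← Real.rpow_add hq0]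
    nth_rewrite 2 [← Real.rpow_one (q : ℝ)]
    rw [← Real.rpow_add hq0]
    push_cast
    apply le_of_eq
    congr 2 <;> ring

/-- Each averaging multiplies the exponential weight by at most `rad q p` and lets information move
one step. The polynomial weight is therefore taken at the least distance reachable in `k` steps,
with truncated subtraction near the root. -/
theorem norm_avg_pow_apply_le (hG : IsHomogeneousTree G q) (hq : 2 ≤ q) (o : V) {p : ℝ}
    (hp1 : 1 < p) (m : ℕ) {a : ℝ} (ha : 0 ≤ a) (φ : schwartz G q o p)
    (hφ : ∀ x, ‖(φ : V → ℂ) x‖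
      ≤ a / (1 + (G.dist o x : ℝ)) ^ m * (q : ℝ) ^ (-((G.dist o x : ℝ) / p))) (k : ℕ) (x : V) :
    ‖((avg hG hq o p ^ k) φ : V → ℂ) x‖
      ≤ a * rad q p ^ k / (1 + ((G.dist o x - k : ℕ) : ℝ)) ^ m
        * (q : ℝ) ^ (-((G.dist o x : ℝ) / p)) := by
  have hs := (rad_pos hq p).le
  induction k generalizing x with
  | zero => simpa using hφ x
  | succ k ih =>
    rw [pow_succ', Module.End.mul_apply, avg_apply, norm_mul]
    have hn : ‖1 / ((q : ℂ) + 1)‖ = 1 / ((q : ℝ) + 1) := by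
      rw [norm_div, norm_one]
      congr 1
      exact_mod_cast Complex.norm_natCast (q + 1)
    rw [hn]
    set D : ℝ := a * rad q p ^ k / (1 + ((G.dist o x - (k + 1) : ℕ) : ℝ)) ^ m with hD
    have hD0 : 0 ≤ D := by positivity
    have h1 : ‖∑ y ∈ G.neighborFinset x, ((avg hG hq o p ^ k) φ : V → ℂ) y‖
        ≤ ∑ y ∈ G.neighborFinset x, D * (q : ℝ) ^ (-((G.dist o y : ℝ) / p)) := by
      refine norm_sum_le_of_le _ fun y hy => (ih y).trans ?_
      have hadj : G.Adj x y := by simpa using hy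
      have hle : G.dist o x - (k + 1) ≤ G.dist o y - k := by
        rcases hadj.diff_dist_adj (u := o) with h | h | h <;> omega
      have hle' : ((G.dist o x - (k + 1) : ℕ) : ℝ) ≤ ((G.dist o y - k : ℕ) : ℝ) := by
        exact_mod_cast hle
      rw [hD]
      gcongr
    rw [← Finset.mul_sum] at h1
    calc _ ≤ 1 / ((q : ℝ) + 1) * (D * (((q : ℝ) + 1) *
          (rad q p * (q : ℝ) ^ (-((G.dist o x : ℝ) / p))))) := by
          gcongr
          exact h1.trans (mul_le_mul_of_nonneg_left (sum_rpow_neg_dist_le hG hq o hp1 x) hD0)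
      _ = _ := by
          rw [hD, pow_succ]
          field_simp

theorem nu_avg_pow_le (hG : IsHomogeneousTree G q) (hq : 2 ≤ q) (o : V) {p : ℝ}
    (hp1 : 1 < p) (m : ℕ) (φ : schwartz G q o p) (k : ℕ) :
    nu G q o p m ((avg hG hq o p ^ k) φ)
      ≤ (1 + (k : ℝ)) ^ m * rad q p ^ k * nu G q o p m φ := by
  have hq0 : (0 : ℝ) < q := by positivity
  have hs := (rad_pos hq p).le
  have : Nonempty V := ⟨o⟩
  refine ciSup_le fun x => ?_
  have h := norm_avg_pow_apply_le hG hq o hp1 m (apply_nonneg (nu G q o p m) φ) φ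
    (norm_apply_le_nu hq m φ) k x
  have hN := apply_nonneg (nu G q o p m) φ
  refine (mul_le_mul_of_nonneg_left h (weight_nonneg _ _ _ _ _ _)).trans ?_
  rw [weight, Real.rpow_neg hq0.le]
  set N := nu G q o p m φ
  set W := (q : ℝ) ^ ((G.dist o x : ℝ) / p)
  have hW : 0 < W := by positivity
  -- Trading the shifted polynomial weight for the original one costs exactly the factor `(1 +
  -- k)^m`.
  have hd : (1 + (G.dist o x : ℝ)) ≤ (1 + (k : ℝ)) * (1 + ((G.dist o x - k : ℕ) : ℝ)) := by
    have : G.dist o x ≤ k + (G.dist o x - k) := by omega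
    have : (G.dist o x : ℝ) ≤ k + ((G.dist o x - k : ℕ) : ℝ) := by exact_mod_cast this
    have : (0 : ℝ) ≤ k * ((G.dist o x - k : ℕ) : ℝ) := by positivity
    linarith
  have hd' := pow_le_pow_left₀ (by positivity) hd m
  rw [mul_pow] at hd'
  set E := (1 + ((G.dist o x - k : ℕ) : ℝ)) ^ m
  have hE : 0 < E := by positivity
  calc (1 + (G.dist o x : ℝ)) ^ m * W * (N * rad q p ^ k / E * W⁻¹)
      = (1 + (G.dist o x : ℝ)) ^ m * (rad q p ^ k * N) / E := by field_simp
    _ ≤ (1 + (k : ℝ)) ^ m * E * (rad q p ^ k * N) / E := by gcongr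
    _ = _ := by field_simp

end Averaging

/-! ### Coefficient norms of polynomials and binomial weights. -/

section CoeffNorm

open Polynomial

/-- The `ℓ¹` norm of the coefficients of a polynomial. -/
def coeffNorm (f : ℝ[X]) : ℝ := f.sum fun _ a => |a|

theorem coeffNorm_eq_sum {f : ℝ[X]} {n : ℕ} (hn : f.natDegree < n) :
    coeffNorm f = ∑ i ∈ Finset.range n, |f.coeff i| :=
  f.sum_over_range' (fun _ => abs_zero) n hn

theorem coeffNorm_nonneg (f : ℝ[X]) : 0 ≤ coeffNorm f :=
  Finset.sum_nonneg fun _ _ => abs_nonneg _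

theorem coeffNorm_monomial (n : ℕ) (a : ℝ) : coeffNorm (monomial n a) = |a| :=
  sum_monomial_index _ _ abs_zero

theorem coeffNorm_add_le (f g : ℝ[X]) : coeffNorm (f + g) ≤ coeffNorm f + coeffNorm g := by
  set n := max (f.natDegree) (g.natDegree) + 1 with hn
  rw [coeffNorm_eq_sum (n := n) (by have := natDegree_add_le f g; omega),
    coeffNorm_eq_sum (f := f) (n := n) (by omega), coeffNorm_eq_sum (f := g) (n := n) (by omega),
    ← Finset.sum_add_distrib]
  refine Finset.sum_le_sum fun i _ => ?_
  rw [coeff_add]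
  exact abs_add_le _ _

theorem coeffNorm_sum_le {ι : Type*} (s : Finset ι) (f : ι → ℝ[X]) :
    coeffNorm (∑ i ∈ s, f i) ≤ ∑ i ∈ s, coeffNorm (f i) :=
  Finset.le_sum_of_subadditive coeffNorm (by simp [coeffNorm]) coeffNorm_add_le s f

theorem coeffNorm_mul_le (f g : ℝ[X]) : coeffNorm (f * g) ≤ coeffNorm f * coeffNorm g := by
  rw [mul_eq_sum_sum]
  refine (coeffNorm_sum_le _ _).trans ?_
  simp only [coeffNorm, Polynomial.sum] at *
  rw [Finset.sum_mul_sum]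
  refine Finset.sum_le_sum fun i _ => ?_
  refine (coeffNorm_sum_le _ _).trans (Finset.sum_le_sum fun j _ => ?_)
  rw [coeffNorm_monomial, abs_mul]

theorem coeffNorm_pow_le (f : ℝ[X]) (n : ℕ) : coeffNorm (f ^ n) ≤ coeffNorm f ^ n := by
  induction n with
  | zero =>
    rw [pow_zero, pow_zero, ← monomial_zero_one, coeffNorm_monomial, abs_one]
  | succ n ih =>
    rw [pow_succ, pow_succ]
    exact (coeffNorm_mul_le _ _).trans
      (mul_le_mul_of_nonneg_right ih (coeffNorm_nonneg f))

theorem coeff_linear_pow (t : ℝ) (n j : ℕ) :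
    ((C (1 - t) + C t * X : ℝ[X]) ^ n).coeff j = n.choose j * t ^ j * (1 - t) ^ (n - j) := by
  rw [add_comm, add_pow, finsetSum_coeff]
  have : ∀ i, ((C t * X : ℝ[X]) ^ i * C (1 - t) ^ (n - i) * (n.choose i : ℝ[X])).coeff j
      = if j = i then n.choose j * t ^ j * (1 - t) ^ (n - j) else 0 := by
    intro i
    have : (C t * X : ℝ[X]) ^ i * C (1 - t) ^ (n - i) * (n.choose i : ℝ[X])
        = C (n.choose i * t ^ i * (1 - t) ^ (n - i)) * X ^ i := by
      rw [← C_eq_natCast]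
      simp only [C_mul, C_pow, mul_pow]
      ring
    rw [this, coeff_C_mul, coeff_X_pow]
    split_ifs with h
    · subst h; simp
    · simp
  simp only [this, Finset.sum_ite_eq, Finset.mem_range]
  split_ifs with h
  · rfl
  · rw [Nat.choose_eq_zero_of_lt (by omega)]
    simp

/-- The coefficients of `(1 - t + tX)^n (X - 1)` in terms of binomial weights. -/
theorem coeff_linear_pow_mul (t : ℝ) (n j : ℕ) :
    ((n : ℝ) + 1) * t * (1 - t) * ((C (1 - t) + C t * X : ℝ[X]) ^ n * (X - 1)).coeff j
      = (j - (n + 1) * t) * ((n + 1).choose j * t ^ j * (1 - t) ^ (n + 1 - j)) := by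
  rw [mul_sub (_ ^ n) X 1, mul_one, coeff_sub]
  rcases j with _ | j
  · rw [coeff_mul_X_zero, coeff_linear_pow]
    simp [pow_succ]
    ring
  · rw [coeff_mul_X, coeff_linear_pow, coeff_linear_pow]
    have h1 : ((n + 1 : ℕ) : ℝ) * n.choose j = (n + 1).choose (j + 1) * ((j + 1 : ℕ) : ℝ) := by
      exact_mod_cast Nat.add_one_mul_choose_eq n j
    have h3 : ((n + 1).choose (j + 1) : ℝ) = n.choose j + n.choose (j + 1) := by
      exact_mod_cast Nat.choose_succ_succ n j
    push_cast at h1 ⊢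
    -- The exponents `n - j` truncate, so the identity is checked separately below, at and above the
    -- top coefficient.
    rcases Nat.lt_trichotomy j n with h | h | h
    · obtain ⟨i, rfl⟩ := Nat.exists_eq_add_of_lt h
      have e1 : j + i + 1 - j = i + 1 := by omega
      have e2 : j + i + 1 - (j + 1) = i := by omega
      rw [e1, e2]
      push_cast at h1 ⊢
      rw [pow_succ, pow_succ]
      linear_combination t ^ j * (1 - t) ^ i * t * (1 - t) * h1 +
        t ^ j * (1 - t) ^ i * t ^ 2 * (1 - t) * (j + i + 1 + 1) * h3
    · subst h
      simp [pow_succ]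
      ring
    · have e1 : n.choose j = 0 := Nat.choose_eq_zero_of_lt h
      have e2 : n.choose (j + 1) = 0 := Nat.choose_eq_zero_of_lt (by omega)
      have e3 : (n + 1).choose (j + 1) = 0 := Nat.choose_eq_zero_of_lt (by omega)
      rw [e1, e2, e3]
      simp

theorem sum_binomial_weight (t : ℝ) (n : ℕ) :
    ∑ j ∈ Finset.range (n + 1), (n.choose j * t ^ j * (1 - t) ^ (n - j) : ℝ) = 1 := by
  have := congrArg (eval t) (bernsteinPolynomial.sum ℝ n)
  simpa [bernsteinPolynomial, eval_finsetSum] using this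

theorem sum_sq_mul_binomial_weight (t : ℝ) (n : ℕ) :
    ∑ j ∈ Finset.range (n + 1),
      ((j - n * t) ^ 2 * (n.choose j * t ^ j * (1 - t) ^ (n - j)) : ℝ) = n * t * (1 - t) := by
  have := congrArg (eval t) (bernsteinPolynomial.variance ℝ n)
  simp only [bernsteinPolynomial, eval_finsetSum, eval_mul, eval_pow, eval_sub, eval_X,
    eval_natCast, eval_one, nsmul_eq_mul] at this
  rw [← this]
  refine Finset.sum_congr rfl fun j _ => ?_
  ring

/-- By `coeff_linear_pow_mul`, the coefficient norm is the mean absolute deviation of a binomial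
variable with `n + 1` trials, divided by its variance `K`. Cauchy–Schwarz bounds the deviation by
`√K`, leaving `K^{-1/2}`. -/
theorem coeffNorm_linear_pow_mul_sq_le {t : ℝ} (h0 : 0 < t) (h1 : t < 1) (n : ℕ) :
    coeffNorm ((C (1 - t) + C t * X : ℝ[X]) ^ n * (X - 1)) ^ 2
      ≤ 1 / (t * (1 - t)) / ((n : ℝ) + 1) := by
  have h1' : 0 < 1 - t := by linarith
  have hdeg : ((C (1 - t) + C t * X : ℝ[X]) ^ n * (X - 1)).natDegree < n + 2 := by
    have : ((C (1 - t) + C t * X : ℝ[X]) ^ n * (X - 1)).natDegree ≤ n * 1 + 1 := by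
      refine natDegree_mul_le_of_le (natDegree_pow_le_of_le _ ?_) ?_ <;> compute_degree
    omega
  rw [coeffNorm_eq_sum hdeg]
  set w : ℕ → ℝ := fun j => (n + 1).choose j * t ^ j * (1 - t) ^ (n + 1 - j) with hw
  have hw0 : ∀ j, 0 ≤ w j := fun j => by positivity
  set K : ℝ := ((n : ℝ) + 1) * t * (1 - t) with hK
  have hK0 : 0 < K := by positivity
  have hc : ∀ j : ℕ, |((C (1 - t) + C t * X : ℝ[X]) ^ n * (X - 1)).coeff j|
      = K⁻¹ * (|j - (n + 1) * t| * √(w j) * √(w j)) := by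
    intro j
    rw [mul_assoc, Real.mul_self_sqrt (hw0 j), ← abs_of_nonneg (hw0 j), ← abs_mul,
      ← coeff_linear_pow_mul, abs_mul, abs_of_pos hK0, inv_mul_cancel_left₀ hK0.ne']
  simp only [hc, ← Finset.mul_sum, mul_pow]
  have hcs := Finset.sum_mul_sq_le_sq_mul_sq (Finset.range (n + 2))
    (fun j : ℕ => |(j : ℝ) - (n + 1) * t| * √(w j)) (fun j => √(w j))
  have hs1 : ∑ j ∈ Finset.range (n + 2), w j = 1 := sum_binomial_weight t (n + 1)
  have hs2 : ∑ j ∈ Finset.range (n + 2), ((j - (n + 1) * t) ^ 2 * w j : ℝ) = K := by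
    have := sum_sq_mul_binomial_weight t (n + 1)
    push_cast at this
    exact this
  simp only [mul_pow, sq_abs, Real.sq_sqrt (hw0 _), hs1, hs2, mul_one] at hcs
  calc K⁻¹ ^ 2 * _ ≤ K⁻¹ ^ 2 * K := by gcongr
    _ = 1 / (t * (1 - t)) / ((n : ℝ) + 1) := by
      rw [hK]
      field_simp

end CoeffNorm

section BackwardSequence

variable {E : Type*} [AddCommGroup E] [Module ℂ E] {L : Module.End ℂ E} {c lam : ℂ}

theorem apply_pow_of_backward {T : ℕ → (E →ₗ[ℂ] ℂ)} (hT : ∀ k φ, T (k + 1) (L φ) = lam * T k φ)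
    (j k : ℕ) (φ : E) : T (j + k) ((L ^ k) φ) = lam ^ k * T j φ := by
  induction k generalizing φ with
  | zero => simp
  | succ k ih =>
    rw [pow_succ', Module.End.mul_apply, ← add_assoc, hT, ih, pow_succ']
    ring

/-- A bounded backward sequence killed by `(L - c)²` is killed by `L - c`, if `‖c‖ = ‖lam‖`. -/
theorem backward_apply_eq_zero_of_sq {T : ℕ → (E →ₗ[ℂ] ℂ)} (hc : c ≠ 0) (hcl : ‖lam‖ = ‖c‖)
    (hT : ∀ k φ, T (k + 1) (L φ) = lam * T k φ) (hb : ∀ φ, ∃ M : ℝ, ∀ k, ‖T k φ‖ ≤ M)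
    (h2 : ∀ k φ, T k (((L - algebraMap ℂ (Module.End ℂ E) c) ^ 2) φ) = 0) (φ : E) :
    T 0 ((L - algebraMap ℂ (Module.End ℂ E) c) φ) = 0 := by
  set D := L - algebraMap ℂ (Module.End ℂ E) c with hD
  have hL : ∀ ψ, L ψ = D ψ + c • ψ := fun ψ => by simp [hD]
  have hDD : ∀ k ψ, T k (D (D ψ)) = 0 := fun k ψ => by simpa [pow_two] using h2 k ψ
  have hcomm : ∀ ψ, D (L ψ) = L (D ψ) := fun ψ => by simp [hD]
  have hD1 : ∀ k j ψ, T k ((L ^ j) (D ψ)) = c ^ j * T k (D ψ) := by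
    intro k j
    induction j with
    | zero => simp
    | succ j ih =>
      intro ψ
      rw [pow_succ, Module.End.mul_apply, ← hcomm, ih, hcomm, hL, map_add, hDD, map_smul,
        smul_eq_mul]
      ring
  -- Modulo `D²`, `L^j = (c + D)^j` is `c^j + j c^{j-1} D`; the extra factor `c` avoids the exponent
  -- `j - 1`.
  have key : ∀ (k j : ℕ) (ψ : E), T k ((L ^ j) ψ) * c = c ^ j * (T k ψ * c + j * T k (D ψ)) := by
    intro k j
    induction j with
    | zero => simp
    | succ j ih =>
      intro ψ
      rw [pow_succ, Module.End.mul_apply, hL, map_add, map_add, map_smul, map_smul, smul_eq_mul,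
        hD1, add_mul, mul_assoc c, ih ψ]
      push_cast
      ring
  have e1 : ∀ k : ℕ, lam ^ k * T 0 φ * c = c ^ k * (T k φ * c + k * T k (D φ)) := by
    intro k
    rw [← key, ← apply_pow_of_backward hT 0 k, zero_add]
  have e2 : ∀ k : ℕ, lam ^ k * T 0 (D φ) = c ^ k * T k (D φ) := by
    intro k
    rw [← hD1, ← apply_pow_of_backward hT 0 k, zero_add]
  obtain ⟨M, hM⟩ := hb φ
  have hc0 : 0 < ‖c‖ := norm_pos_iff.2 hc
  have hn : ∀ k : ℕ, (k : ℝ) * ‖T 0 (D φ)‖ ≤ 2 * M * ‖c‖ := by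
    intro k
    have h3 : lam ^ k * (k * T 0 (D φ)) = lam ^ k * T 0 φ * c - c ^ k * (T k φ * c) := by
      rw [e1]
      linear_combination (k : ℂ) * e2 k
    have h4 := congrArg norm h3
    rw [norm_mul, norm_mul, Complex.norm_natCast, norm_pow, hcl] at h4
    have h5 : ‖lam ^ k * T 0 φ * c - c ^ k * (T k φ * c)‖
        ≤ ‖c‖ ^ k * (2 * M * ‖c‖) := by
      refine (norm_sub_le _ _).trans ?_
      simp only [norm_mul, norm_pow, hcl]
      have := mul_le_mul_of_nonneg_left (add_le_add (hM 0) (hM k))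
        (by positivity : 0 ≤ ‖c‖ ^ k * ‖c‖)
      linarith
    exact le_of_mul_le_mul_left (h4.trans_le h5) (by positivity)
  by_contra hne
  have hpos : 0 < ‖T 0 (D φ)‖ := norm_pos_iff.2 hne
  obtain ⟨k, hk⟩ := exists_nat_gt (2 * M * ‖c‖ / ‖T 0 (D φ)‖)
  rw [div_lt_iff₀ hpos] at hk
  exact absurd (hn k) (not_le.2 hk)

theorem backward_apply_eq_zero_of_pow {T : ℕ → (E →ₗ[ℂ] ℂ)} (hc : c ≠ 0) (hcl : ‖lam‖ = ‖c‖)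
    (hT : ∀ k φ, T (k + 1) (L φ) = lam * T k φ) (hb : ∀ φ, ∃ M : ℝ, ∀ k, ‖T k φ‖ ≤ M) (n : ℕ)
    (hn : ∀ k φ, T k (((L - algebraMap ℂ (Module.End ℂ E) c) ^ (n + 1)) φ) = 0) (k : ℕ) (φ : E) :
    T k ((L - algebraMap ℂ (Module.End ℂ E) c) φ) = 0 := by
  induction n generalizing k φ with
  | zero => simpa using hn k φ
  | succ n ih =>
    refine ih (fun k φ => ?_) k φ
    set D := L - algebraMap ℂ (Module.End ℂ E) c with hD
    have hcomm : Commute (D ^ n) L := by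
      refine Commute.pow_left ?_ n
      exact (Commute.refl L).sub_left (Algebra.commutes c L)
    -- Composing with `D^n` turns annihilation by `D^{n+2}` into annihilation by `D²`; the shift by
    -- `k` is needed because the square case concludes only at index `0`.
    have := backward_apply_eq_zero_of_sq (T := fun j => T (j + k) ∘ₗ (D ^ n)) (L := L) (c := c)
      (lam := lam) hc hcl (fun j ψ => ?_) (fun ψ => ?_) (fun j ψ => ?_) φ
    · rw [pow_succ, Module.End.mul_apply]
      simpa only [zero_add, LinearMap.comp_apply] using this
    · have : (D ^ n) (L ψ) = L ((D ^ n) ψ) := DFunLike.congr_fun hcomm.eq ψ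
      simp only [LinearMap.comp_apply, this]
      rw [← hT, add_right_comm]
    · obtain ⟨M, hM⟩ := hb ((D ^ n) ψ)
      exact ⟨M, fun j => hM (j + k)⟩
    · simp only [LinearMap.comp_apply, ← Module.End.mul_apply]
      rw [← hD, ← pow_add]
      exact hn _ ψ

end BackwardSequence

/-! ### Polynomials in the normalised averaging operator, and powers of the Laplacian. -/

section Growth

open Polynomial

variable {V : Type*} {G : SimpleGraph V} [G.LocallyFinite] {q : ℕ}

/-- The averaging operator normalised to spectral radius one, up to sign. -/
def normAvg (hG : IsHomogeneousTree G q) (hq : 2 ≤ q) (o : V) (p : ℝ) :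
    Module.End ℂ (schwartz G q o p) := (-(1 / (rad q p : ℂ))) • avg hG hq o p

theorem nu_normAvg_pow_le (hG : IsHomogeneousTree G q) (hq : 2 ≤ q) (o : V) {p : ℝ}
    (hp1 : 1 < p) (m : ℕ) (φ : schwartz G q o p) (k : ℕ) :
    nu G q o p m ((normAvg hG hq o p ^ k) φ) ≤ (1 + (k : ℝ)) ^ m * nu G q o p m φ := by
  have hs := rad_pos hq p
  rw [normAvg, _root_.smul_pow, LinearMap.smul_apply, map_smul_eq_mul, norm_pow, norm_neg, norm_div,
    norm_one, Complex.norm_real, Real.norm_of_nonneg hs.le]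
  calc _ ≤ (1 / rad q p) ^ k * ((1 + (k : ℝ)) ^ m * rad q p ^ k * nu G q o p m φ) := by
        gcongr
        exact nu_avg_pow_le hG hq o hp1 m φ k
    _ = _ := by
        rw [div_pow, one_pow]
        field_simp

/-- Since powers of the normalised operator grow only polynomially, operator estimates reduce to the
degree and the coefficient norm of a real polynomial. -/
theorem nu_aeval_normAvg_le (hG : IsHomogeneousTree G q) (hq : 2 ≤ q) (o : V) {p : ℝ}
    (hp1 : 1 < p) (m : ℕ) (φ : schwartz G q o p) (f : ℝ[X]) {n : ℕ} (hn : f.natDegree ≤ n) :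
    nu G q o p m (aeval (normAvg hG hq o p) (f.map Complex.ofRealHom) φ)
      ≤ coeffNorm f * (1 + (n : ℝ)) ^ m * nu G q o p m φ := by
  have hN := apply_nonneg (nu G q o p m) φ
  rw [aeval_eq_sum_range' (n := n + 1) ((natDegree_map_le).trans_lt (by omega)),
    LinearMap.sum_apply, coeffNorm_eq_sum (n := n + 1) (by omega), Finset.sum_mul, Finset.sum_mul]
  refine (Finset.le_sum_of_subadditive (nu G q o p m) (map_zero _).le (map_add_le_add _) _
    _).trans (Finset.sum_le_sum fun i hi => ?_)
  have hi : (i : ℝ) ≤ n := by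
    have := Finset.mem_range.1 hi
    exact_mod_cast (by omega : i ≤ n)
  rw [LinearMap.smul_apply, map_smul_eq_mul, coeff_map, Complex.ofRealHom_eq_coe,
    Complex.norm_real, Real.norm_eq_abs, mul_assoc]
  gcongr
  refine (nu_normAvg_pow_le hG hq o hp1 m φ i).trans ?_
  gcongr

/-- The barycentric parameter `t` with `𝓛 = (1 + rad q p) (1 - t + t B)`, `B` the normalised
averaging operator. -/
def bary (q : ℕ) (p : ℝ) : ℝ := rad q p / (1 + rad q p)

theorem bary_pos {q : ℕ} (hq : 2 ≤ q) (p : ℝ) : 0 < bary q p := by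
  have := rad_pos hq p
  unfold bary
  positivity

theorem bary_lt_one {q : ℕ} (hq : 2 ≤ q) (p : ℝ) : bary q p < 1 := by
  have := rad_pos hq p
  rw [bary, div_lt_one (by positivity)]
  linarith

/-- The minus sign in the normalisation makes both coefficients positive with sum `1`, so no power
of this linear polynomial has coefficient norm above `1`. -/
theorem one_sub_eq_aeval {E : Type*} [AddCommGroup E] [Module ℂ E] (A : Module.End ℂ E) {s : ℝ}
    (hs : 0 < s) :
    1 - A = ((1 + s : ℝ) : ℂ) • aeval ((-(1 / (s : ℂ))) • A)
      ((C (1 - s / (1 + s)) + C (s / (1 + s)) * X : ℝ[X]).map Complex.ofRealHom) := by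
  have hs0 : (s : ℂ) ≠ 0 := by exact_mod_cast hs.ne'
  have hs1 : (1 + s : ℂ) ≠ 0 := by
    have : (1 + s : ℝ) ≠ 0 := by positivity
    exact_mod_cast this
  simp only [Polynomial.map_add, Polynomial.map_mul, map_C, map_X, map_add, map_mul, aeval_C,
    aeval_X, Algebra.algebraMap_eq_smul_one, Complex.ofRealHom_eq_coe, smul_add,
    smul_mul_assoc, one_mul, smul_smul]
  have hα : ((1 + s : ℝ) : ℂ) * ((1 - s / (1 + s) : ℝ) : ℂ) = 1 := by
    push_cast
    field_simp
    ring
  have hβ : ((1 + s : ℝ) : ℂ) * (((s / (1 + s) : ℝ) : ℂ) * -(1 / (s : ℂ))) = -1 := by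
    push_cast
    field_simp
  rw [hα, hβ, one_smul, neg_one_smul, sub_eq_add_neg]

theorem one_sub_sub_eq_aeval {E : Type*} [AddCommGroup E] [Module ℂ E] (A : Module.End ℂ E)
    {s : ℝ} (hs : 0 < s) :
    1 - A - algebraMap ℂ _ ((1 + s : ℝ) : ℂ)
      = (s : ℂ) • aeval ((-(1 / (s : ℂ))) • A) ((X - 1 : ℝ[X]).map Complex.ofRealHom) := by
  have hs0 : (s : ℂ) ≠ 0 := by exact_mod_cast hs.ne'
  simp only [Polynomial.map_sub, Polynomial.map_one, map_X, map_sub, map_one, aeval_X,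
    smul_sub, smul_smul]
  have : (s : ℂ) * -(1 / (s : ℂ)) = -1 := by field_simp
  rw [this, neg_one_smul, Complex.ofReal_add, Complex.ofReal_one, map_add, map_one,
    Algebra.algebraMap_eq_smul_one]
  abel

theorem lap_eq_one_sub_avg (hG : IsHomogeneousTree G q) (hq : 2 ≤ q) (o : V) (p : ℝ) :
    lap hG hq o p = 1 - avg hG hq o p :=
  (sub_sub_cancel (1 : Module.End ℂ (schwartz G q o p)) (lap hG hq o p)).symm

theorem lap_eq_aeval (hG : IsHomogeneousTree G q) (hq : 2 ≤ q) (o : V) (p : ℝ) :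
    lap hG hq o p = ((1 + rad q p : ℝ) : ℂ) • aeval (normAvg hG hq o p)
      ((C (1 - bary q p) + C (bary q p) * X : ℝ[X]).map Complex.ofRealHom) :=
  (lap_eq_one_sub_avg hG hq o p).trans (one_sub_eq_aeval _ (rad_pos hq p))

theorem lap_sub_eq_aeval (hG : IsHomogeneousTree G q) (hq : 2 ≤ q) (o : V) (p : ℝ) :
    lap hG hq o p - algebraMap ℂ _ ((1 + rad q p : ℝ) : ℂ)
      = (rad q p : ℂ) • aeval (normAvg hG hq o p) ((X - 1 : ℝ[X]).map Complex.ofRealHom) := by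
  rw [lap_eq_one_sub_avg]
  exact one_sub_sub_eq_aeval _ (rad_pos hq p)

theorem nu_lap_pow_le (hG : IsHomogeneousTree G q) (hq : 2 ≤ q) (o : V) {p : ℝ}
    (hp1 : 1 < p) (m : ℕ) (φ : schwartz G q o p) (k : ℕ) :
    nu G q o p m ((lap hG hq o p ^ k) φ)
      ≤ (1 + rad q p) ^ k * ((1 + (k : ℝ)) ^ m * nu G q o p m φ) := by
  have hs := rad_pos hq p
  have h0 := bary_pos hq p
  have h1 := bary_lt_one hq p
  have hN := apply_nonneg (nu G q o p m) φ
  rw [lap_eq_aeval, _root_.smul_pow, ← map_pow, ← Polynomial.map_pow, LinearMap.smul_apply,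
    map_smul_eq_mul, norm_pow, Complex.norm_real, Real.norm_of_nonneg (by positivity)]
  gcongr
  set f : ℝ[X] := C (1 - bary q p) + C (bary q p) * X with hf
  have hdeg : f.natDegree ≤ 1 := by
    rw [hf]
    compute_degree
  refine (nu_aeval_normAvg_le hG hq o hp1 m φ (f ^ k) (n := k) ?_).trans ?_
  · simpa using natDegree_pow_le_of_le k hdeg
  · have hf1 : coeffNorm f ≤ 1 := by
      rw [coeffNorm_eq_sum (n := 2) (by omega)]
      simp [hf, Finset.sum_range_succ, coeff_X, coeff_C, coeff_one, abs_of_pos h0,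
        abs_of_pos (sub_pos.2 h1)]
    have hfk : coeffNorm (f ^ k) ≤ 1 :=
      (coeffNorm_pow_le f k).trans (pow_le_one₀ (coeffNorm_nonneg f) hf1)
    calc _ ≤ 1 * (1 + (k : ℝ)) ^ m * nu G q o p m φ := by gcongr
      _ = _ := by ring

/-- The polynomial involved is the `2(m+1)`-th power of `(1 - t + tX)^n (X - 1)`. Its coefficient
norm is `O(n^{-(m+1)})`, while its degree, linear in `n`, costs `O(n^m)`; a factor `1/n` survives.
-/
theorem exists_nu_lap_pow_mul_le (hG : IsHomogeneousTree G q) (hq : 2 ≤ q) (o : V) {p : ℝ}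
    (hp1 : 1 < p) (m : ℕ) (φ : schwartz G q o p) :
    ∃ K : ℝ, ∀ n : ℕ, nu G q o p m ((lap hG hq o p ^ (n * (2 * (m + 1))))
      (((lap hG hq o p - algebraMap ℂ _ ((1 + rad q p : ℝ) : ℂ)) ^ (2 * (m + 1))) φ))
        ≤ (1 + rad q p) ^ (n * (2 * (m + 1))) * (K / ((n : ℝ) + 1)) := by
  have hs := rad_pos hq p
  have h0 := bary_pos hq p
  have h1 := bary_lt_one hq p
  have hN := apply_nonneg (nu G q o p m) φ
  set N := 2 * (m + 1) with hNdef
  set t := bary q p with ht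
  set κ : ℝ := 1 / (t * (1 - t)) with hκ
  have hκ0 : 0 < κ := by
    have : 0 < 1 - t := by linarith
    positivity
  refine ⟨rad q p ^ N * (κ ^ (m + 1) * (1 + (N : ℝ)) ^ m * nu G q o p m φ), fun n => ?_⟩
  rw [← Module.End.mul_apply, lap_sub_eq_aeval, lap_eq_aeval, _root_.smul_pow, _root_.smul_pow,
    smul_mul_smul_comm, ← map_pow, ← map_pow, ← map_mul, ← Polynomial.map_pow,
    ← Polynomial.map_pow, ← Polynomial.map_mul, LinearMap.smul_apply,
    map_smul_eq_mul, norm_mul, norm_pow, norm_pow, Complex.norm_real, Complex.norm_real,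
    Real.norm_of_nonneg hs.le, Real.norm_of_nonneg (by positivity), mul_assoc, ← ht, mul_div_assoc]
  gcongr
  rw [pow_mul, ← mul_pow]
  set f : ℝ[X] := (C (1 - t) + C t * X) ^ n * (X - 1) with hf
  have hdeg : f.natDegree ≤ n + 1 := by
    have : f.natDegree ≤ n * 1 + 1 := by
      refine natDegree_mul_le_of_le (natDegree_pow_le_of_le _ ?_) ?_ <;> compute_degree
    omega
  refine (nu_aeval_normAvg_le hG hq o hp1 m φ (f ^ N) (n := N * (n + 1))
    (natDegree_pow_le_of_le N hdeg)).trans ?_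
  have hn0 : (0 : ℝ) < (n : ℝ) + 1 := by positivity
  have hfN : coeffNorm (f ^ N) ≤ κ ^ (m + 1) / ((n : ℝ) + 1) ^ (m + 1) := by
    refine (coeffNorm_pow_le f N).trans ?_
    rw [hNdef, pow_mul, ← div_pow]
    exact pow_le_pow_left₀ (sq_nonneg _) (coeffNorm_linear_pow_mul_sq_le h0 h1 n) _
  have hpoly : (1 + ((N * (n + 1) : ℕ) : ℝ)) ^ m ≤ ((1 + (N : ℝ)) * ((n : ℝ) + 1)) ^ m := by
    refine pow_le_pow_left₀ (by positivity) ?_ m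
    push_cast
    have : (0 : ℝ) ≤ n := by positivity
    linarith
  calc _ ≤ κ ^ (m + 1) / ((n : ℝ) + 1) ^ (m + 1) * ((1 + (N : ℝ)) * ((n : ℝ) + 1)) ^ m
        * nu G q o p m φ := by gcongr
    _ = _ := by
      rw [mul_pow, pow_succ ((n : ℝ) + 1)]
      field_simp

theorem distLaplacian_apply (hG : IsHomogeneousTree G q) (hq : 2 ≤ q) {o : V} {p : ℝ}
    (T : schwartz G q o p →ₗ[ℂ] ℂ) (φ : schwartz G q o p) :
    distLaplacian hG hq T φ = T (lap hG hq o p φ) := rfl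

/-! ### The cases of modulus above and equal to the upper threshold. -/

section Solution

variable {hG : IsHomogeneousTree G q} {hq : 2 ≤ q} {o : V} {p : ℝ} {lam : ℂ}
  {T : ℕ → (schwartz G q o p →ₗ[ℂ] ℂ)}

theorem IsBackwardSolution.apply_lap (h : IsBackwardSolution hG hq lam T) (k : ℕ)
    (φ : schwartz G q o p) : T (k + 1) (lap hG hq o p φ) = lam * T k φ :=
  DFunLike.congr_fun (h.laplacian_eq k) φ

theorem IsBackwardSolution.exists_norm_le (h : IsBackwardSolution hG hq lam T) :
    ∃ (m : ℕ) (C : ℝ), 0 ≤ C ∧ ∀ k φ, ‖T k φ‖ ≤ C * nu G q o p m φ := by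
  obtain ⟨ν, ⟨m, C, hC⟩, M, hM, hb⟩ := h.bounded
  refine ⟨m, M * |C|, by positivity, fun k φ => (hb k φ).trans ?_⟩
  rw [mul_assoc]
  gcongr
  exact (hC φ).trans (mul_le_mul_of_nonneg_right (le_abs_self C) (apply_nonneg _ _))

theorem IsBackwardSolution.eq_zero (h : IsBackwardSolution hG hq lam T) (hp1 : 1 < p)
    (hlam : 1 + rad q p < ‖lam‖) (j : ℕ) : T j = 0 := by
  obtain ⟨m, C, hC, hb⟩ := h.exists_norm_le
  have hs := rad_pos hq p
  have hl : 0 < ‖lam‖ := by linarith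
  ext φ
  rw [LinearMap.zero_apply, ← norm_le_zero_iff]
  set r := (1 + rad q p) / ‖lam‖ with hr
  have hr0 : 0 < r := by positivity
  have hr1 : r < 1 := (div_lt_one hl).2 hlam
  -- The shift to `k + 1`, paid for by `r⁻¹`, puts the bound in the form `n^m r^n`, which tends to
  -- zero.
  have hle : ∀ k : ℕ, ‖T j φ‖
      ≤ C * nu G q o p m φ * r⁻¹ * (((k + 1 : ℕ) : ℝ) ^ m * r ^ (k + 1)) := by
    intro k
    have h1 := congrArg norm (apply_pow_of_backward h.apply_lap j k φ)
    rw [norm_mul, norm_pow] at h1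
    have h2 := (h1.symm.trans_le (hb _ _)).trans
      (mul_le_mul_of_nonneg_left (nu_lap_pow_le hG hq o hp1 m φ k) hC)
    rw [mul_comm, ← le_div_iff₀ (by positivity)] at h2
    refine h2.trans (le_of_eq ?_)
    rw [pow_succ r, hr, div_pow]
    push_cast
    field_simp
    ring
  have hlim : Filter.Tendsto
      (fun k : ℕ => C * nu G q o p m φ * r⁻¹ * (((k + 1 : ℕ) : ℝ) ^ m * r ^ (k + 1)))
      Filter.atTop (𝓝 (C * nu G q o p m φ * r⁻¹ * 0)) :=
    ((tendsto_pow_const_mul_const_pow_of_abs_lt_one m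
      (by rwa [abs_of_pos hr0])).comp (Filter.tendsto_add_atTop_nat 1)).const_mul _
  rw [mul_zero] at hlim
  exact ge_of_tendsto' hlim hle

theorem IsBackwardSolution.distLaplacian_eq (h : IsBackwardSolution hG hq lam T) (hp1 : 1 < p)
    (hlam : ‖lam‖ = 1 + rad q p) (j : ℕ) : distLaplacian hG hq (T j) = (‖lam‖ : ℂ) • T j := by
  obtain ⟨m, C, hC, hb⟩ := h.exists_norm_le
  have hs := rad_pos hq p
  have hl : 0 < ‖lam‖ := by linarith
  -- The left side does not depend on `n`: moving `n * (2 * (m + 1))` steps back bounds it by a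
  -- multiple of `1/(n + 1)`.
  have hpow : ∀ k φ, T k (((lap hG hq o p - algebraMap ℂ _ (‖lam‖ : ℂ)) ^ (2 * m + 1 + 1)) φ)
      = 0 := by
    intro k φ
    obtain ⟨K, hK⟩ := exists_nu_lap_pow_mul_le hG hq o hp1 m φ
    rw [← norm_le_zero_iff]
    have hle : ∀ n : ℕ,
        ‖T k (((lap hG hq o p - algebraMap ℂ _ (‖lam‖ : ℂ)) ^ (2 * m + 1 + 1)) φ)‖
          ≤ C * K * (1 / ((n : ℝ) + 1)) := by
      intro n
      have h1 := congrArg norm (apply_pow_of_backward h.apply_lap k (n * (2 * (m + 1)))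
        (((lap hG hq o p - algebraMap ℂ _ (‖lam‖ : ℂ)) ^ (2 * (m + 1))) φ))
      rw [norm_mul, norm_pow] at h1
      rw [← hlam] at hK
      have h2 := (h1.symm.trans_le (hb _ _)).trans (mul_le_mul_of_nonneg_left (hK n) hC)
      rw [mul_left_comm C] at h2
      refine (le_of_mul_le_mul_left h2 (by positivity)).trans (le_of_eq ?_)
      ring
    have hlim : Filter.Tendsto (fun n : ℕ => C * K * (1 / ((n : ℝ) + 1))) Filter.atTop
        (𝓝 (C * K * 0)) := tendsto_one_div_add_atTop_nhds_zero_nat.const_mul _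
    rw [mul_zero] at hlim
    exact ge_of_tendsto' hlim hle
  ext φ
  have := backward_apply_eq_zero_of_pow (c := (‖lam‖ : ℂ)) (by exact_mod_cast hl.ne')
    (by simp) h.apply_lap (fun φ => ⟨_, fun k => hb k φ⟩) (2 * m + 1) hpow j φ
  rw [distLaplacian_apply, LinearMap.smul_apply, smul_eq_mul, ← sub_eq_zero, ← this]
  simp

end Solution

end Growth

/-! ### Functions of dual decay as tempered distributions. -/

section Pairing

variable {V : Type*} {G : SimpleGraph V} {q : ℕ}

/-- `|f(x)| ≤ C ρ^{|x|}` with `ρ = q^{-1/p'}`, the growth that makes `f` an `L^p`-tempered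
distribution. -/
def HasDualDecay (G : SimpleGraph V) (q : ℕ) (o : V) (p : ℝ) (f : V → ℂ) : Prop :=
  ∃ C : ℝ, 0 ≤ C ∧ ∀ x, ‖f x‖ ≤ C * ((q : ℝ) ^ (1 / p - 1)) ^ G.dist o x

/-- The two exponential rates multiply to `q^{-|x|}`, which offsets the size of the spheres; the
seminorm of index `2` supplies a summable remainder. -/
theorem norm_mul_le_of_decay (hq : 2 ≤ q) {o : V} {p : ℝ} {f : V → ℂ} {C : ℝ}
    (hC : 0 ≤ C) (hf : ∀ x, ‖f x‖ ≤ C * ((q : ℝ) ^ (1 / p - 1)) ^ G.dist o x)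
    (φ : schwartz G q o p) (x : V) :
    ‖f x * (φ : V → ℂ) x‖ ≤ C * nu G q o p 2 φ *
      (((q : ℝ) ^ G.dist o x)⁻¹ * (1 / (1 + (G.dist o x : ℝ)) ^ 2)) := by
  have hq0 : (0 : ℝ) < q := by positivity
  have hN := apply_nonneg (nu G q o p 2) φ
  rw [norm_mul]
  refine (mul_le_mul (hf x) (norm_apply_le_nu hq 2 φ x) (norm_nonneg _) (by positivity)).trans
    (le_of_eq ?_)
  have : ((q : ℝ) ^ (1 / p - 1)) ^ G.dist o x * (q : ℝ) ^ (-((G.dist o x : ℝ) / p))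
      = ((q : ℝ) ^ G.dist o x)⁻¹ := by
    rw [← Real.rpow_natCast, ← Real.rpow_mul hq0.le, ← Real.rpow_add hq0,
      ← Real.rpow_natCast (q : ℝ), ← Real.rpow_neg hq0.le]
    congr 1
    ring
  rw [← this]
  ring

theorem isTempered_of_norm_le {o : V} {p : ℝ} {T : schwartz G q o p →ₗ[ℂ] ℂ} {K : ℝ} {m : ℕ}
    (h : ∀ φ, ‖T φ‖ ≤ K * nu G q o p m φ) : IsTempered T := by
  intro f hf
  refine squeeze_zero_norm (fun n => h (f n)) ?_
  simpa using (hf m).const_mul K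

/-- The pointwise absolute value of a Schwartz function. -/
def schwartzNorm {o : V} {p : ℝ} (φ : schwartz G q o p) : schwartz G q o p :=
  ⟨fun x => (‖(φ : V → ℂ) x‖ : ℂ), fun m => by simpa using φ.2 m⟩

/-- The point mass at a vertex. -/
def pointMass (G : SimpleGraph V) (q : ℕ) (o : V) (p : ℝ) (z : V) : schwartz G q o p :=
  ⟨fun x => by classical exact if x = z then 1 else 0, fun m => by
    refine ⟨weight G q o p m z, ?_⟩
    rintro _ ⟨x, rfl⟩
    by_cases h : x = z
    · simp [h]
    · simpa [h] using weight_nonneg G q o p m z⟩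

variable [G.LocallyFinite]

theorem summable_sphere_weight (hG : IsHomogeneousTree G q) (hq : 2 ≤ q) (o : V) :
    Summable fun x : V => (((q : ℝ) ^ G.dist o x)⁻¹ * (1 / (1 + (G.dist o x : ℝ)) ^ 2)) := by
  classical
  have hq0 : (0 : ℝ) < q := by positivity
  have hsum : Summable fun n : ℕ => 2 * (1 / (1 + (n : ℝ)) ^ 2) := by
    have h := (summable_nat_add_iff 1).2 (Real.summable_one_div_nat_pow.2 (le_refl 2))
    refine (h.congr fun n => ?_).mul_left 2
    push_cast
    rw [add_comm]
  refine summable_of_sum_le (c := ∑' n : ℕ, 2 * (1 / (1 + (n : ℝ)) ^ 2))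
    (fun x => by positivity) fun u => ?_
  rw [← Finset.sum_fiberwise_of_maps_to (g := fun x => G.dist o x) (t := u.image (G.dist o))
    (fun x hx => Finset.mem_image_of_mem _ hx)]
  refine le_trans (Finset.sum_le_sum fun n _ => ?_)
    (hsum.sum_le_tsum _ fun n _ => by positivity)
  obtain ⟨S, hS, hc⟩ := exists_finset_sphere hG o n
  have hcard : ((u.filter fun x => G.dist o x = n).card : ℝ) ≤ 2 * (q : ℝ) ^ n := by
    have h1 : (u.filter fun x => G.dist o x = n).card ≤ S.card :=
      Finset.card_le_card fun x hx => (hS x).2 (Finset.mem_filter.1 hx).2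
    -- At `n = 0` the general sphere bound `q + 1` exceeds `2`, so that sphere is counted directly.
    have h2 : (q + 1) * q ^ (n - 1) ≤ 2 * q ^ n ∨ n = 0 := by
      rcases n with _ | n
      · exact Or.inr rfl
      · left
        rw [Nat.add_sub_cancel, pow_succ]
        nlinarith [Nat.zero_le (q ^ n), Nat.mul_le_mul_left (q ^ n) hq]
    have h3 : (u.filter fun x => G.dist o x = n).card ≤ 2 * q ^ n := by
      rcases h2 with h2 | h2
      · exact h1.trans (hc.trans h2)
      · subst h2
        have : (u.filter fun x => G.dist o x = 0).card ≤ ({o} : Finset V).card := by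
          refine Finset.card_le_card fun x hx => ?_
          have := (Finset.mem_filter.1 hx).2
          rw [hG.tree.connected.dist_eq_zero_iff] at this
          simp [this]
        simp only [Finset.card_singleton] at this
        simpa using this.trans one_le_two
    exact_mod_cast h3
  have hconst : ∀ x ∈ u.filter fun x => G.dist o x = n,
      ((q : ℝ) ^ G.dist o x)⁻¹ * (1 / (1 + (G.dist o x : ℝ)) ^ 2)
        = ((q : ℝ) ^ n)⁻¹ * (1 / (1 + (n : ℝ)) ^ 2) := by
    intro x hx
    rw [(Finset.mem_filter.1 hx).2]
  rw [Finset.sum_congr rfl hconst, Finset.sum_const, nsmul_eq_mul, ← mul_assoc]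
  refine mul_le_mul_of_nonneg_right ?_ (by positivity)
  rw [← div_eq_mul_inv, div_le_iff₀ (by positivity)]
  exact hcard

theorem HasDualDecay.summable {o : V} {p : ℝ} {f : V → ℂ} (hf : HasDualDecay G q o p f)
    (hG : IsHomogeneousTree G q) (hq : 2 ≤ q) (φ : schwartz G q o p) :
    Summable fun x => f x * (φ : V → ℂ) x := by
  obtain ⟨C, hC, hf⟩ := hf
  exact Summable.of_norm_bounded ((summable_sphere_weight hG hq o).mul_left _)
    (norm_mul_le_of_decay hq hC hf φ)

/-- The distribution `φ ↦ ∑ f(x) φ(x)`. -/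
def pairing (hG : IsHomogeneousTree G q) (hq : 2 ≤ q) {o : V} {p : ℝ} (f : V → ℂ)
    (hf : HasDualDecay G q o p f) : schwartz G q o p →ₗ[ℂ] ℂ where
  toFun φ := ∑' x, f x * (φ : V → ℂ) x
  map_add' φ ψ := by
    rw [← (hf.summable hG hq φ).tsum_add (hf.summable hG hq ψ)]
    simp [mul_add]
  map_smul' c φ := by
    rw [RingHom.id_apply, smul_eq_mul, ← tsum_mul_left]
    simp [mul_left_comm]

theorem exists_norm_pairing_le (hG : IsHomogeneousTree G q) (hq : 2 ≤ q) {o : V} {p : ℝ}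
    (f : V → ℂ) (hf : HasDualDecay G q o p f) :
    ∃ K : ℝ, 0 ≤ K ∧ ∀ φ, ‖pairing hG hq f hf φ‖ ≤ K * nu G q o p 2 φ := by
  have hS := summable_sphere_weight hG hq o
  obtain ⟨C, hC, hb⟩ := id hf
  refine ⟨C * ∑' x : V, (((q : ℝ) ^ G.dist o x)⁻¹ * (1 / (1 + (G.dist o x : ℝ)) ^ 2)),
    mul_nonneg hC (tsum_nonneg fun x => by positivity), fun φ => ?_⟩
  refine (tsum_of_norm_bounded (hS.hasSum.mul_left _)
    (norm_mul_le_of_decay hq hC hb φ)).trans (le_of_eq ?_)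
  ring

/-- Summation by parts for the averaging operator. -/
theorem tsum_mul_sum_neighborFinset (hG : IsHomogeneousTree G q) (hq : 2 ≤ q) {o : V} {p : ℝ}
    {f : V → ℂ} (hf : HasDualDecay G q o p f) (φ : schwartz G q o p) :
    ∑' x, f x * ∑ y ∈ G.neighborFinset x, (φ : V → ℂ) y
      = ∑' x, (∑ y ∈ G.neighborFinset x, f y) * (φ : V → ℂ) x := by
  classical
  have hq0 : ((q : ℂ) + 1) ≠ 0 := by exact_mod_cast Nat.succ_ne_zero q
  set F : V → V → ℂ := fun x y => if G.Adj x y then f x * (φ : V → ℂ) y else 0 with hF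
  have hrow : ∀ x, HasSum (F x) (f x * ∑ y ∈ G.neighborFinset x, (φ : V → ℂ) y) := by
    intro x
    rw [Finset.mul_sum]
    have : ∑ y ∈ G.neighborFinset x, f x * (φ : V → ℂ) y = ∑ y ∈ G.neighborFinset x, F x y := by
      refine Finset.sum_congr rfl fun y hy => ?_
      rw [hF]
      simp only
      rw [if_pos (by simpa using hy)]
    rw [this]
    refine hasSum_sum_of_ne_finset_zero fun y hy => ?_
    exact if_neg (by simpa using hy)
  have hcol : ∀ y, HasSum (fun x => F x y) ((∑ x ∈ G.neighborFinset y, f x) * (φ : V → ℂ) y) := by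
    intro y
    rw [Finset.sum_mul]
    have : ∑ x ∈ G.neighborFinset y, f x * (φ : V → ℂ) y = ∑ x ∈ G.neighborFinset y, F x y := by
      refine Finset.sum_congr rfl fun x hx => ?_
      have hx : G.Adj y x := by simpa using hx
      exact (if_pos hx.symm).symm
    rw [this]
    refine hasSum_sum_of_ne_finset_zero fun x hx => ?_
    exact if_neg fun h => hx (by simpa using h.symm)
  have hnorm : ∀ x, HasSum (fun y => ‖F x y‖)
      (‖f x‖ * ∑ y ∈ G.neighborFinset x, ‖(φ : V → ℂ) y‖) := by
    intro x
    rw [Finset.mul_sum]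
    have : ∑ y ∈ G.neighborFinset x, ‖f x‖ * ‖(φ : V → ℂ) y‖
        = ∑ y ∈ G.neighborFinset x, ‖F x y‖ := by
      refine Finset.sum_congr rfl fun y hy => ?_
      have hy : G.Adj x y := by simpa using hy
      rw [hF]
      simp only
      rw [if_pos hy, norm_mul]
    rw [this]
    refine hasSum_sum_of_ne_finset_zero fun y hy => ?_
    rw [hF]
    simp only
    rw [if_neg (by simpa using hy), norm_zero]
  -- Absolute summability over ordered edges, as Fubini requires, is the summability of `f` against
  -- the average of `|φ|`, again a Schwartz function.
  have hsum : Summable (Function.uncurry F) := by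
    rw [← summable_norm_iff, summable_prod_of_nonneg fun _ => norm_nonneg _]
    refine ⟨fun x => (hnorm x).summable, ?_⟩
    have h := ((hf.summable hG hq (avg hG hq o p (schwartzNorm φ))).norm).mul_left ((q : ℝ) + 1)
    refine h.congr fun x => ?_
    rw [show ∑' y, ‖Function.uncurry F (x, y)‖ = _ from (hnorm x).tsum_eq, avg_apply, norm_mul,
      norm_mul]
    have e1 : ‖1 / ((q : ℂ) + 1)‖ = 1 / ((q : ℝ) + 1) := by
      rw [norm_div, norm_one]
      congr 1
      exact_mod_cast Complex.norm_natCast (q + 1)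
    have e2 : ‖∑ y ∈ G.neighborFinset x, (schwartzNorm φ : V → ℂ) y‖
        = ∑ y ∈ G.neighborFinset x, ‖(φ : V → ℂ) y‖ := by
      simp only [schwartzNorm]
      rw [← Complex.ofReal_sum, Complex.norm_real,
        Real.norm_of_nonneg (Finset.sum_nonneg fun _ _ => norm_nonneg _)]
    rw [e1, e2]
    field_simp
  calc _ = ∑' x, ∑' y, F x y := tsum_congr fun x => (hrow x).tsum_eq.symm
    _ = ∑' y, ∑' x, F x y := hsum.tsum_comm.symm
    _ = _ := tsum_congr fun y => (hcol y).tsum_eq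

theorem pairing_lap (hG : IsHomogeneousTree G q) (hq : 2 ≤ q) {o : V} {p : ℝ}
    {f : V → ℂ} (hf : HasDualDecay G q o p f) {α : ℂ} (hα : laplacian G q f = α • f)
    (φ : schwartz G q o p) :
    pairing hG hq f hf (lap hG hq o p φ) = α * pairing hG hq f hf φ := by
  have hq0 : ((q : ℂ) + 1) ≠ 0 := by exact_mod_cast Nat.succ_ne_zero q
  have h1 : pairing hG hq f hf (avg hG hq o p φ) = (1 - α) * pairing hG hq f hf φ := by
    have e1 : ∀ x, f x * (avg hG hq o p φ : V → ℂ) x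
        = 1 / ((q : ℂ) + 1) * (f x * ∑ y ∈ G.neighborFinset x, (φ : V → ℂ) y) := by
      intro x
      rw [avg_apply]
      ring
    have e2 : ∀ x, 1 / ((q : ℂ) + 1) * ((∑ y ∈ G.neighborFinset x, f y) * (φ : V → ℂ) x)
        = (1 - α) * (f x * (φ : V → ℂ) x) := by
      intro x
      have := congrFun hα x
      simp only [laplacian, LinearMap.coe_mk, AddHom.coe_mk, Pi.smul_apply, smul_eq_mul] at this
      linear_combination -(φ : V → ℂ) x * this
    change ∑' x, f x * (avg hG hq o p φ : V → ℂ) x = (1 - α) * ∑' x, f x * (φ : V → ℂ) x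
    rw [tsum_congr e1, tsum_mul_left, tsum_mul_sum_neighborFinset hG hq hf, ← tsum_mul_left,
      tsum_congr e2, tsum_mul_left]
  have h2 : lap hG hq o p φ = φ - avg hG hq o p φ := by
    rw [lap_eq_one_sub_avg]
    rfl
  rw [h2, map_sub, h1]
  ring

theorem pairing_pointMass (hG : IsHomogeneousTree G q) (hq : 2 ≤ q) {o : V} {p : ℝ}
    {f : V → ℂ} (hf : HasDualDecay G q o p f) (z : V) :
    pairing hG hq f hf (pointMass G q o p z) = f z := by
  classical
  change ∑' x, f x * (if x = z then 1 else 0) = f z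
  rw [tsum_eq_single z (fun x hx => by simp [hx])]
  simp

end Pairing

/-! ### Radial eigenfunctions and their eigenvalues. -/

section Spherical

/-- The recurrence of spherical functions, solved by `c₁ rⁿ + c₂ (qr)⁻ⁿ`. -/
theorem exists_spherical_sequence {q : ℕ} (hq : 2 ≤ q) {p : ℝ} (hp1 : 1 < p) (hp2 : p < 2)
    {r : ℂ} (hr : ‖r‖ = (q : ℝ) ^ (1 / p - 1)) :
    ∃ F : ℕ → ℂ, F 0 = 1 ∧ F 1 = (q * r + r⁻¹) / (q + 1) ∧
      (∀ n, (q * r + r⁻¹) * F (n + 1) = F n + q * F (n + 2)) ∧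
      ∃ C : ℝ, 0 ≤ C ∧ ∀ n, ‖F n‖ ≤ C * ((q : ℝ) ^ (1 / p - 1)) ^ n := by
  have hq1 : (1 : ℝ) < q := by exact_mod_cast (by omega : 1 < q)
  have hq0 : (0 : ℝ) < q := by linarith
  have hqc : (q : ℂ) ≠ 0 := by exact_mod_cast hq0.ne'
  have hqc1 : ((q : ℂ) + 1) ≠ 0 := by exact_mod_cast Nat.succ_ne_zero q
  have hr0 : r ≠ 0 := by
    rw [← norm_pos_iff, hr]
    positivity
  -- The second characteristic root: the product of the roots is `1/q`. It is strictly smaller in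
  -- modulus because `p < 2`, so the roots are distinct and `r` governs the decay.
  set r' : ℂ := (q * r)⁻¹ with hr'
  have hnr' : ‖r'‖ < ‖r‖ := by
    have h1 : ‖r'‖ = (q : ℝ) ^ (-(1 / p)) := by
      rw [hr', norm_inv, norm_mul, Complex.norm_natCast, hr]
      nth_rewrite 1 [← Real.rpow_one (q : ℝ)]
      rw [← Real.rpow_add hq0, ← Real.rpow_neg hq0.le]
      congr 1
      ring
    rw [h1, hr]
    refine Real.rpow_lt_rpow_of_exponent_lt hq1 ?_
    have : 1 / 2 < 1 / p := one_div_lt_one_div_of_lt (by linarith) hp2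
    linarith
  have hne : r - r' ≠ 0 := by
    intro h
    rw [sub_eq_zero.1 h] at hnr'
    exact lt_irrefl _ hnr'
  set β : ℂ := (q * r + r⁻¹) / (q + 1) with hβ
  -- The coefficients are fixed by the values `1` at `0` and `β` at `1`; the latter is the
  -- eigenvalue equation at the root.
  set c₁ : ℂ := (β - r') / (r - r') with hc₁
  set c₂ : ℂ := (r - β) / (r - r') with hc₂
  refine ⟨fun n => c₁ * r ^ n + c₂ * r' ^ n, ?_, ?_, fun n => ?_, ‖c₁‖ + ‖c₂‖, by positivity,
    fun n => ?_⟩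
  · simp only [pow_zero, mul_one]
    rw [hc₁, hc₂, ← add_div, div_eq_one_iff_eq hne]
    ring
  · simp only [pow_one]
    rw [hc₁, hc₂]
    field_simp
    ring
  · have e1 : q * r * r' = 1 := mul_inv_cancel₀ (mul_ne_zero hqc hr0)
    have e3 : r⁻¹ = q * r' := by
      rw [hr', mul_inv, mul_inv_cancel_left₀ hqc]
    rw [e3]
    simp only [pow_succ]
    linear_combination (c₁ * r ^ n + c₂ * r' ^ n) * e1
  · rw [← hr, add_mul]
    refine (norm_add_le _ _).trans (add_le_add ?_ ?_)
    · rw [norm_mul, norm_pow]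
    · rw [norm_mul, norm_pow]
      gcongr

variable {V : Type*} {G : SimpleGraph V} [G.LocallyFinite] {q : ℕ}

theorem exists_spherical (hG : IsHomogeneousTree G q) (hq : 2 ≤ q) (o : V) {p : ℝ} (hp1 : 1 < p)
    (hp2 : p < 2) {r : ℂ} (hr : ‖r‖ = (q : ℝ) ^ (1 / p - 1)) :
    ∃ f : V → ℂ, HasDualDecay G q o p f ∧ f o = 1 ∧
      laplacian G q f = (1 - (q * r + r⁻¹) / (q + 1)) • f := by
  have hqc1 : ((q : ℂ) + 1) ≠ 0 := by exact_mod_cast Nat.succ_ne_zero q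
  obtain ⟨F, h0, h1, hrec, C, hC, hb⟩ := exists_spherical_sequence hq hp1 hp2 hr
  refine ⟨fun x => F (G.dist o x), ⟨C, hC, fun x => hb _⟩, by simpa using h0, ?_⟩
  funext x
  simp only [laplacian, LinearMap.coe_mk, AddHom.coe_mk, Pi.smul_apply, smul_eq_mul]
  by_cases hx : x = o
  · subst hx
    rw [sum_neighborFinset_radial_root hG F, SimpleGraph.dist_self, h0, h1, nsmul_eq_mul]
    push_cast
    field_simp
  · rw [sum_neighborFinset_radial hG F hx, nsmul_eq_mul]
    have hpos : 0 < G.dist o x := hG.tree.connected.pos_dist_of_ne (Ne.symm hx)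
    obtain ⟨n, hn⟩ := Nat.exists_eq_succ_of_ne_zero hpos.ne'
    rw [hn, Nat.succ_sub_one, ← hrec n]
    ring

/-- On the circle `‖r‖ = q^{-1/p'}` the spectral parameter `1 - (q r + r⁻¹) / (q + 1)` attains
every modulus in `(1 - rad q p, 1 + rad q p)` at a non-real value. -/
theorem exists_spectral_parameter {q : ℕ} (hq : 2 ≤ q) {p : ℝ} (hp1 : 1 < p) (hp2 : p < 2)
    {ℓ : ℝ} (h1 : 1 - rad q p < ℓ) (h2 : ℓ < 1 + rad q p) :
    ∃ r : ℂ, ‖r‖ = (q : ℝ) ^ (1 / p - 1) ∧ ‖1 - (q * r + r⁻¹) / (q + 1)‖ = ℓ ∧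
      ((q * r + r⁻¹) / (q + 1)).im ≠ 0 := by
  have hq1 : (1 : ℝ) < q := by exact_mod_cast (by omega : 1 < q)
  have hq0 : (0 : ℝ) < q := by linarith
  set ρ : ℝ := (q : ℝ) ^ (1 / p - 1) with hρ
  have hρ0 : 0 < ρ := by positivity
  have hρ1 : q * ρ = (q : ℝ) ^ (1 / p) := by
    rw [hρ]
    nth_rewrite 1 [← Real.rpow_one (q : ℝ)]
    rw [← Real.rpow_add hq0]
    congr 1
    ring
  have hρ2 : ρ⁻¹ = (q : ℝ) ^ (1 - 1 / p) := by
    rw [hρ, ← Real.rpow_neg hq0.le]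
    congr 1
    ring
  have hlt : ρ⁻¹ < q * ρ := by
    rw [hρ1, hρ2]
    refine Real.rpow_lt_rpow_of_exponent_lt hq1 ?_
    have : 1 / 2 < 1 / p := one_div_lt_one_div_of_lt (by linarith) hp2
    linarith
  have hp' : 1 / p < 1 := by
    rw [div_lt_one (by linarith)]
    exact hp1
  have hrad : rad q p = (q * ρ + ρ⁻¹) / (q + 1) := by rw [rad, hρ1, hρ2]
  -- Needed to remove the absolute value from `|1 - rad q p|` at `θ = 0`; it amounts to `(qρ -
  -- 1)(ρ⁻¹ - 1) > 0`.
  have hrad1 : rad q p < 1 := by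
    rw [hrad, div_lt_one (by linarith)]
    have h3 : 1 < ρ⁻¹ := by
      rw [hρ2]
      exact Real.one_lt_rpow hq1 (by linarith)
    have h4 : 1 < q * ρ := h3.trans hlt
    have h5 : q * ρ * ρ⁻¹ = q := mul_inv_cancel_right₀ hρ0.ne' _
    nlinarith
  set R : ℝ → ℂ := fun θ => ρ * Complex.exp (θ * Complex.I) with hR
  have hRn : ∀ θ, ‖R θ‖ = ρ := fun θ => by
    rw [hR]
    simp only
    rw [norm_mul, Complex.norm_exp_ofReal_mul_I, mul_one, Complex.norm_real,
      Real.norm_of_nonneg hρ0.le]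
  have hR0 : ∀ θ, R θ ≠ 0 := fun θ => by
    rw [← norm_pos_iff, hRn]
    exact hρ0
  set g : ℝ → ℝ := fun θ => ‖1 - (q * R θ + (R θ)⁻¹) / (q + 1)‖ with hg
  have hcont : Continuous g := by
    have hRc : Continuous R := by
      rw [hR]
      fun_prop
    have := hRc.inv₀ hR0
    rw [hg]
    fun_prop
  have hg0 : g 0 = 1 - rad q p := by
    have : (1 : ℂ) - (q * R 0 + (R 0)⁻¹) / (q + 1) = ((1 - rad q p : ℝ) : ℂ) := by
      rw [hrad, hR]
      push_cast
      simp
    rw [hg]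
    simp only
    rw [this, Complex.norm_real, Real.norm_of_nonneg (by linarith)]
  have hgπ : g Real.pi = 1 + rad q p := by
    have : (1 : ℂ) - (q * R Real.pi + (R Real.pi)⁻¹) / (q + 1) = ((1 + rad q p : ℝ) : ℂ) := by
      rw [hrad, hR]
      simp only [Complex.exp_pi_mul_I]
      push_cast
      rw [mul_neg_one, inv_neg]
      ring
    rw [hg]
    simp only
    rw [this, Complex.norm_real, Real.norm_of_nonneg (by linarith)]
  obtain ⟨θ, hθ, hθℓ⟩ := intermediate_value_Ioo Real.pi_pos.le hcont.continuousOn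
    (show ℓ ∈ Set.Ioo (g 0) (g Real.pi) by rw [hg0, hgπ]; exact ⟨h1, h2⟩)
  refine ⟨R θ, hRn θ, hθℓ, ?_⟩
  -- The parameter traces an ellipse whose imaginary semiaxis is nonzero because `ρ⁻¹ < qρ`, so it
  -- is non-real for `0 < θ < π`.
  have him : (q * R θ + (R θ)⁻¹) / (q + 1)
      = (((q * ρ + ρ⁻¹) / (q + 1) * Real.cos θ : ℝ) : ℂ)
        + (((q * ρ - ρ⁻¹) / (q + 1) * Real.sin θ : ℝ) : ℂ) * Complex.I := by
    have e : (R θ)⁻¹ = ((ρ⁻¹ : ℝ) : ℂ) * (Real.cos θ - Real.sin θ * Complex.I) := by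
      rw [hR]
      simp only
      rw [mul_inv, ← Complex.exp_neg, ← neg_mul, ← Complex.ofReal_neg, Complex.exp_mul_I,
        ← Complex.ofReal_cos, ← Complex.ofReal_sin, Real.cos_neg, Real.sin_neg]
      push_cast
      ring
    rw [e, hR]
    simp only [Complex.exp_mul_I]
    push_cast
    ring
  rw [him, Complex.add_im, Complex.ofReal_im, zero_add, Complex.im_ofReal_mul, Complex.I_im,
    mul_one]
  have hsin := Real.sin_pos_of_pos_of_lt_pi hθ.1 hθ.2
  have : 0 < q * ρ - ρ⁻¹ := sub_pos.2 hlt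
  positivity

end Spherical

/-! ### The counterexample between the thresholds. -/

theorem exists_backward_not_eigen {V : Type*} {G : SimpleGraph V} [G.LocallyFinite] {q : ℕ}
    (hG : IsHomogeneousTree G q) (hq : 2 ≤ q) (o : V) {p : ℝ} (hp1 : 1 < p) (hp2 : p < 2)
    {lam : ℂ} (hlam : lam ≠ 0) (h1 : 1 - rad q p < ‖lam‖) (h2 : ‖lam‖ < 1 + rad q p) :
    ∃ T : ℕ → (schwartz G q o p →ₗ[ℂ] ℂ), IsBackwardSolution hG hq lam T ∧
      ¬ ∃ μ : ℂ, distLaplacian hG hq (T 0) = μ • T 0 := by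
  obtain ⟨r, hr, hα, him⟩ := exists_spectral_parameter hq hp1 hp2 h1 h2
  obtain ⟨f₁, hf₁, ho₁, he₁⟩ := exists_spherical hG hq o hp1 hp2 hr
  obtain ⟨f₂, hf₂, ho₂, he₂⟩ := exists_spherical hG hq o hp1 hp2
    (r := (starRingEnd ℂ) r) (by rwa [Complex.norm_conj])
  have hconj : (1 : ℂ) - (q * (starRingEnd ℂ) r + ((starRingEnd ℂ) r)⁻¹) / (q + 1)
      = (starRingEnd ℂ) (1 - (q * r + r⁻¹) / (q + 1)) := by simp
  rw [hconj] at he₂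
  have him' : (1 - (q * r + r⁻¹) / (q + 1)).im ≠ 0 := by simpa using him
  set α : ℂ := 1 - (q * r + r⁻¹) / (q + 1) with hαdef
  set α' : ℂ := (starRingEnd ℂ) α with hα'
  have hα'n : ‖α'‖ = ‖lam‖ := by rw [hα', Complex.norm_conj, hα]
  have hl : 0 < ‖lam‖ := norm_pos_iff.2 hlam
  have hα0 : α ≠ 0 := by rwa [← norm_pos_iff, hα]
  have hα'0 : α' ≠ 0 := by rwa [← norm_pos_iff, hα'n]
  set P₁ := pairing hG hq f₁ hf₁ with hP₁
  set P₂ := pairing hG hq f₂ hf₂ with hP₂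
  have hL₁ : ∀ φ, P₁ (lap hG hq o p φ) = α * P₁ φ := pairing_lap hG hq hf₁ he₁
  have hL₂ : ∀ φ, P₂ (lap hG hq o p φ) = α' * P₂ φ := pairing_lap hG hq hf₂ he₂
  obtain ⟨K₁, hK₁, hb₁⟩ := exists_norm_pairing_le hG hq f₁ hf₁
  obtain ⟨K₂, hK₂, hb₂⟩ := exists_norm_pairing_le hG hq f₂ hf₂
  have hbound : ∀ k φ, ‖((lam / α) ^ k • P₁ + (lam / α') ^ k • P₂) φ‖
      ≤ (K₁ + K₂) * nu G q o p 2 φ := by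
    intro k φ
    rw [LinearMap.add_apply, LinearMap.smul_apply, LinearMap.smul_apply, add_mul]
    refine (norm_add_le _ _).trans (add_le_add ?_ ?_)
    · rw [norm_smul, norm_pow, norm_div, hα, div_self hl.ne', one_pow, one_mul]
      exact hb₁ φ
    · rw [norm_smul, norm_pow, norm_div, hα'n, div_self hl.ne', one_pow, one_mul]
      exact hb₂ φ
  -- Both ratios have modulus one, hence uniform boundedness; the `+ 1` makes the constant strictly
  -- positive.
  refine ⟨fun k => (lam / α) ^ k • P₁ + (lam / α') ^ k • P₂,
    ⟨fun k => isTempered_of_norm_le (hbound k), fun k => ?_, nu G q o p 2,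
      ⟨2, 1, fun φ => (one_mul _).ge⟩, K₁ + K₂ + 1, by positivity, fun k φ => ?_⟩, ?_⟩
  · ext φ
    rw [distLaplacian_apply]
    simp only [LinearMap.add_apply, LinearMap.smul_apply, smul_eq_mul, hL₁, hL₂, pow_succ]
    field_simp
  · refine (hbound k φ).trans ?_
    have := apply_nonneg (nu G q o p 2) φ
    linarith
  · rintro ⟨μ, hμ⟩
    have hev : ∀ φ, α * P₁ φ + α' * P₂ φ = μ * (P₁ φ + P₂ φ) := by
      intro φ
      have := DFunLike.congr_fun hμ φ
      rw [distLaplacian_apply] at this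
      simpa [hL₁, hL₂, mul_add] using this
    have hδ₁ : P₁ (pointMass G q o p o) = 1 := (pairing_pointMass hG hq hf₁ o).trans ho₁
    have hδ₂ : P₂ (pointMass G q o p o) = 1 := (pairing_pointMass hG hq hf₂ o).trans ho₂
    have ha := hev (pointMass G q o p o)
    have hb := hev (lap hG hq o p (pointMass G q o p o))
    rw [hL₁, hL₂, hδ₁, hδ₂] at hb
    rw [hδ₁, hδ₂] at ha
    -- Testing on the point mass at `o` and on its Laplacian gives `α + α' = 2μ` and `α² + α'² = μ(α
    -- + α')`; eliminating `μ` forces `α = α'`, so `α` would be real.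
    have hsq : (α - α') ^ 2 = 0 := by
      linear_combination 2 * hb - (α + α') * ha
    have hαα : α = α' := sub_eq_zero.1 (pow_eq_zero_iff two_ne_zero |>.1 hsq)
    exact him' (Complex.conj_eq_iff_im.1 hαα.symm)

end HomTree

end

theorem lemmaB2 {V : Type*} (G : SimpleGraph V) [G.LocallyFinite] (q : ℕ) (hq : 2 ≤ q)
    (hG : HomTree.IsHomogeneousTree G q) (o : V) (p : ℝ) (hp1 : 1 < p) (hp2 : p < 2)
    (lam : ℂ) (hlam : lam ≠ 0) :
    (∀ T : ℕ → (HomTree.schwartz G q o p →ₗ[ℂ] ℂ),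
      HomTree.IsBackwardSolution hG hq lam T → ‖lam‖ = HomTree.gamHigh q p →
        HomTree.distLaplacian hG hq (T 0) = (‖lam‖ : ℂ) • T 0) ∧
    (∀ T : ℕ → (HomTree.schwartz G q o p →ₗ[ℂ] ℂ),
      HomTree.IsBackwardSolution hG hq lam T → HomTree.gamHigh q p < ‖lam‖ →
        ∀ k, T k = 0) ∧
    (HomTree.gamLow q p < ‖lam‖ → ‖lam‖ < HomTree.gamHigh q p →
      ∃ T : ℕ → (HomTree.schwartz G q o p →ₗ[ℂ] ℂ),
        HomTree.IsBackwardSolution hG hq lam T ∧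
          ¬ ∃ μ : ℂ, HomTree.distLaplacian hG hq (T 0) = μ • T 0) := by
  rw [HomTree.gamHigh_eq hq hp1, HomTree.gamLow_eq q hp1]
  exact ⟨fun T hT h => hT.distLaplacian_eq hp1 h 0, fun T hT h => hT.eq_zero hp1 h,
    HomTree.exists_backward_not_eigen hG hq o hp1 hp2 hlam⟩
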